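/- Let $k$ be a field of characteristic $0$, let $M\ge 1$, and let $\zeta\in k$ be a primitive $M$-th root of unity (such a $\zeta$ exists for every $M$ if, for instance, $k$ is algebraically closed). Let $V$ be a vertex algebra over $k$, with $n$-th products $u_nv$ ($n\in\mathbb Z$) and vacuum $\mathbf 1$, and let $g,h$ be automorphisms of $V$ with $g^M=h^M=\mathrm{id}$. For $r\in\mathbb Z$ put $V^{g,r}=\{v\in V : gv=\zeta^{-r}v\}$, which depends only on $r$ modulo $M$. *Twisted loop algebras.* The space $V\otimes_k k[t^{\pm 1/M}]$ is a vertex algebra with vacuum $\mathbf 1\otimes 1$ and products $$(u\otimes s)_n(v\otimes s')=\sum_{j\ge 0}u_{n+j}v\otimes \tfrac{1}{j!}\Big(\tfrac{d}{dt}\Big)^{j}(s)\,s'.$$ Let $L(V,g)=\bigoplus_{0\le r<M}V^{g,r}\otimes t^{r/M}k[t^{\pm1}]$ be the vertex subalgebra of fixed points of $g\otimes\gamma$, where $\gamma$ is the $k$-algebra automorphism $t^{1/M}\mapsto\zeta t^{1/M}$. It is a vertex algebra over the differential ring $(k[t^{\pm1}],\frac{d}{dt})$ through the structure map $p\mapsto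 \mathbf 1\otimes p$. For $v\in V^{g,r}$ and $n\in\frac rM+\mathbb Z$ write $v_{(n)}=v\otimes t^n\in L(V,g)$. Define $L(V,h)$ in the same way. A $k[t^{\pm1}]$-vertex algebra map $L(V,g)\to L(V,h)$ is an additive map that preserves all $n$-th products and the vacuum and commutes with the structure maps from $k[t^{\pm1}]$. *Twisted modules.* A weak $g$-twisted $V$-module is a $k$-vector space $W$ with a $k$-linear map $v\mapsto Y_W(v,z)=\sum_{n\in\frac1M\mathbb Z}v_nz^{-n-1}$, $v_n\in\operatorname{End}_k(W)$, such that: $v_n=0$ if $v\in V^{g,r}$ and $n\notin\frac rM+\mathbb Z$; for all $v\in V$ and $w\in W$, $v_nw=0$ for $n\gg0$; $Y_W(\mathbf 1,z)=\mathrm{id}_W$; and for all $0\le r<M$, $u\in V^{g,r}$, $v\in V$ the twisted Jacobi identity $$z_0^{-1}\delta\Big(\frac{z_1-z_2}{z_0}\Big)Y_W(u,z_1)Y_W(v,z_2)-z_0^{-1}\delta\Big(\frac{z_2-z_1}{-z_0}\Big)Y_W(v,z_2)Y_W(u,z_1)=z_2^{-1}\Big(\frac{z_1-z_0}{z_2}\Big)^{-r/M}\delta\Big(\frac{z_1-z_0}{z_2}\Big)Y_W(Y(u,z_0)v,z_2)$$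 holds. **Proposition.** Let $\varphi\colon L(V,g)\to L(V,h)$ be a $k[t^{\pm1}]$-vertex algebra map, and let $W$ be a weak $h$-twisted $V$-module with vertex operator map $Y_W(v,z)=\sum_{n\in\frac1M\mathbb Z}v_nz^{-n-1}$. Let $\overline\varphi\colon L(V,g)\to\operatorname{End}_k(W)$ be the composite of $\varphi$ with the linear map $L(V,h)\to\operatorname{End}_k(W)$, $v_{(n)}\mapsto v_n$. Then there is exactly one linear map $\varphi^*Y_W\colon V\to\operatorname{End}_k(W)[[z^{1/M},z^{-1/M}]]$ with $$(\varphi^*Y_W)(v,z)=\sum_{n\in\frac rM+\mathbb Z}\overline\varphi(v_{(n)})\,z^{-n-1}\qquad(r\in\mathbb Z,\ v\in V^{g,r}),$$ and it makes $W$ into a weak $g$-twisted $V$-module. -/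

import Mathlib

open scoped TensorProduct

/-- A vertex algebra over a commutative ring `k` (without differential structure on `k`): a
`k`-module with `k`-bilinear `n`-th products `u_n v` and a vacuum vector, satisfying regularity,
creation, and the Jacobi identity, the latter written out in coefficients of the formal variables.
The sums over `i` have only finitely many nonzero terms by regularity. For `k = ℤ` this is a vertex
ring. -/
class VertexAlgebra (k V : Type*) [CommRing k] [AddCommGroup V] [Module k V] where
  /-- `nprod n u v` is `u_n v`, the coefficient of `z ^ (-n - 1)` in `Y(u, z) v`. -/
  nprod : ℤ → V →ₗ[k] V →ₗ[k] V
  vac : V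
  regular : ∀ u v : V, ∃ N : ℤ, ∀ n : ℤ, N ≤ n → nprod n u v = 0
  creation_nonneg : ∀ (v : V) (n : ℤ), 0 ≤ n → nprod n v vac = 0
  creation_neg_one : ∀ v : V, nprod (-1) v vac = v
  jacobi : ∀ (u v w : V) (l m n : ℤ),
    ∑ᶠ i : ℕ, Ring.choose m i • nprod (m + n - i) (nprod (l + i) u v) w =
    ∑ᶠ i : ℕ, ((-1) ^ i * Ring.choose l i) •
      (nprod (m + l - i) u (nprod (n + i) v w) -
        (l.negOnePow : ℤ) • nprod (n + l - i) v (nprod (m + i) u w))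

/-- An iterative Hasse-Schmidt derivation on a commutative `k`-algebra `S`, i.e. the structure of a
commutative vertex ring over `k`; `k` consists of constants. -/
class HasseSchmidt (k S : Type*) [CommRing k] [CommRing S] [Algebra k S] where
  D : ℕ → S →ₗ[k] S
  D_zero : ∀ s : S, D 0 s = s
  D_mul : ∀ (n : ℕ) (s t : S),
    D n (s * t) = ∑ p ∈ Finset.HasAntidiagonal.antidiagonal n, D p.1 s * D p.2 t
  D_comp : ∀ (i j : ℕ) (s : S), D i (D j s) = (i + j).choose i • D (i + j) s

namespace HasseSchmidt

variable (k : Type*) {S : Type*} [CommRing k] [CommRing S] [Algebra k S] [HasseSchmidt k S]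

/-- The `n`-th product of the commutative vertex ring attached to a Hasse-Schmidt derivation:
`Y(r, z) s = ∑_{j ≥ 0} D_j(r) s z ^ j`, so `r_n s = D_{-n-1}(r) s` for `n < 0`, and `0` else. -/
def nprod (n : ℤ) (r s : S) : S := if n < 0 then D (k := k) (-n - 1).toNat r * s else 0

end HasseSchmidt

namespace VertexAlgebra

section Basic

variable {k V : Type*} [CommRing k] [AddCommGroup V] [Module k V] [VertexAlgebra k V]

lemma finsum_eq_range {A : Type*} [AddCommMonoid A] (f : ℕ → A) (K : ℕ)
    (h : ∀ i, K ≤ i → f i = 0) : ∑ᶠ i, f i = ∑ i ∈ Finset.range K, f i := by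
  apply finsum_eq_sum_of_support_subset
  intro i hi
  simp only [Finset.coe_range, Set.mem_Iio]
  by_contra hc
  exact hi (h i (not_lt.mp hc))

variable (k) in
lemma exists_bound (u v : V) : ∃ N : ℕ, ∀ n : ℤ, (N : ℤ) ≤ n → nprod (k := k) n u v = 0 := by
  obtain ⟨N, hN⟩ := regular (k := k) u v
  exact ⟨N.toNat, fun n hn => hN n ((Int.self_le_toNat N).trans hn)⟩

/-- The Jacobi identity with explicitly truncated sums. -/
lemma jacobi_range (u v w : V) (l m n : ℤ) (K : ℕ)
    (h1 : ∀ i : ℕ, K ≤ i → nprod (k := k) (l + i) u v = 0)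
    (h2 : ∀ i : ℕ, K ≤ i → nprod (k := k) (n + i) v w = 0)
    (h3 : ∀ i : ℕ, K ≤ i → nprod (k := k) (m + i) u w = 0) :
    ∑ i ∈ Finset.range K, Ring.choose m i • nprod (k := k) (m + n - i) (nprod (k := k) (l + i) u v) w =
    ∑ i ∈ Finset.range K, ((-1) ^ i * Ring.choose l i) •
      (nprod (k := k) (m + l - i) u (nprod (k := k) (n + i) v w) -
        (l.negOnePow : ℤ) • nprod (k := k) (n + l - i) v (nprod (k := k) (m + i) u w)) := by
  have := jacobi (k := k) u v w l m n
  rwa [finsum_eq_range _ K, finsum_eq_range _ K] at this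
  · intro i hi; simp [h2 i hi, h3 i hi]
  · intro i hi; simp [h1 i hi]

/-- Skew symmetry, in a form with a truncated sum. -/
lemma skew (u v : V) (l : ℤ) (K : ℕ) (h1 : ∀ i : ℕ, K ≤ i → nprod (k := k) (l + i) u v = 0) :
    nprod (k := k) l v u = -((l.negOnePow : ℤ) • ∑ i ∈ Finset.range K,
      (-1 : ℤ) ^ i • nprod (k := k) (-1 - i) (nprod (k := k) (l + i) u v) (vac (k := k))) := by
  have h := jacobi (k := k) u v (vac (k := k) : V) l (-1) 0
  rw [finsum_eq_range _ K, finsum_eq_range _ 1] at h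
  · have e : ∀ i : ℕ, Ring.choose (-1 : ℤ) i = (-1) ^ i := by
      intro i
      have := Ring.choose_neg (1 : ℤ) i
      rw [this, show (1 : ℤ) + i - 1 = ((i : ℕ) : ℤ) by ring, Ring.choose_natCast]
      simp [Int.negOnePow_def, Units.smul_def]
    simp only [e] at h
    have h4 : nprod (k := k) 0 v (vac (k := k) : V) = 0 := creation_nonneg v 0 le_rfl
    simp only [add_zero, Finset.range_one, Finset.sum_singleton, pow_zero, one_mul, Nat.cast_zero,
      zero_add, sub_zero, Ring.choose_zero_right, one_smul, h4, map_zero, zero_sub,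
      creation_neg_one] at h
    rw [h, smul_neg, neg_neg, smul_smul]
    rcases Int.even_or_odd l with hl | hl
    · simp [Int.negOnePow_even l hl]
    · simp [Int.negOnePow_odd l hl]
  · intro i hi
    have h4 : nprod (k := k) (0 + i) v (vac (k := k) : V) = 0 := creation_nonneg v _ (by positivity)
    have h5 : nprod (k := k) (-1 + i) u (vac (k := k) : V) = 0 := creation_nonneg u _ (by omega)
    rw [h4, h5]; simp
  · intro i hi; simp [h1 i hi]

variable (k) in
/-- The canonical Hasse-Schmidt derivation `D_m v = v_{-m-1} 1`. -/
def canD (m : ℕ) (v : V) : V := nprod (k := k) (-1 - m) v (vac (k := k))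

lemma canD_vac (m : ℕ) (hm : 0 < m) : canD k m (vac (k := k) : V) = 0 := by
  induction m using Nat.strong_induction_on with
  | _ m ih =>
    have h := skew (k := k) (vac (k := k) : V) (vac (k := k)) (-1 - m) (m + 1)
      (fun i hi => creation_nonneg _ _ (by omega))
    obtain ⟨p, rfl⟩ : ∃ p, m = p + 1 := ⟨m - 1, by omega⟩
    rw [Finset.sum_range_succ, Finset.sum_range_succ'] at h
    have h0 : ∑ i ∈ Finset.range p, (-1 : ℤ) ^ (i + 1) • nprod (k := k) (-1 - ((i + 1 : ℕ) : ℤ))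
        (nprod (k := k) (-1 - ((p + 1 : ℕ) : ℤ) + ((i + 1 : ℕ) : ℤ)) (vac (k := k) : V) (vac (k := k))) (vac (k := k))
          = 0 := by
      apply Finset.sum_eq_zero
      intro i hi
      rw [Finset.mem_range] at hi
      have := ih (p - i) (by omega) (by omega)
      unfold canD at this
      rw [show -1 - ((p + 1 : ℕ) : ℤ) + ((i + 1 : ℕ) : ℤ) = -1 - ((p - i : ℕ) : ℤ) by omega, this]
      simp
    rw [h0] at h
    have h1 : -1 - ((p + 1 : ℕ) : ℤ) + ((p + 1 : ℕ) : ℤ) = -1 := by omega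
    rw [h1, creation_neg_one] at h
    change nprod (k := k) (-1 - ((p + 1 : ℕ) : ℤ)) (vac (k := k) : V) (vac (k := k)) = 0
    simp only [Nat.cast_zero, sub_zero, add_zero, creation_neg_one, pow_zero, one_smul,
      zero_add] at h
    set x := nprod (k := k) (-1 - ((p + 1 : ℕ) : ℤ)) (vac (k := k) : V) (vac (k := k))
    rcases Nat.even_or_odd p with hp | hp
    · have e1 : ((-1 : ℤ)) ^ (p + 1) = -1 := (Even.add_one hp).neg_one_pow
      rw [e1] at h
      simpa using h
    · have e1 : ((-1 : ℤ)) ^ (p + 1) = 1 := (Odd.add_one hp).neg_one_pow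
      have e2 : (-1 - ((p + 1 : ℕ) : ℤ)).negOnePow = -1 := by
        apply Int.negOnePow_odd
        obtain ⟨q, rfl⟩ := hp
        exact ⟨-q - 2, by push_cast; ring⟩
      rw [e1, e2] at h
      simpa using h

lemma canD_comp (i j : ℕ) (v : V) : canD k i (canD k j v) = (i + j).choose i • canD k (i + j) v := by
  have h := jacobi (k := k) v (vac (k := k) : V) (vac (k := k)) (-1 - j) 0 (-1 - i)
  rw [finsum_eq_range _ 1, Finset.sum_range_one, finsum_eq_range _ (i + 1),
    Finset.sum_range_succ _ i] at h
  · rw [Finset.sum_eq_zero] at h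
    · have h1 : nprod (k := k) (0 + (i : ℤ)) v (vac (k := k) : V) = 0 := creation_nonneg _ _ (by positivity)
      have h2 : (-1 : ℤ) ^ i * Ring.choose (-1 - (j : ℤ)) i = (i + j).choose i := by
        rw [show -1 - (j : ℤ) = -((j : ℤ) + 1) by ring, Ring.choose_neg,
          show (j : ℤ) + 1 + i - 1 = ((i + j : ℕ) : ℤ) by push_cast; ring, Ring.choose_natCast]
        simp only [Int.negOnePow_def, Units.smul_def, zpow_natCast, Units.val_pow_eq_pow_val,
          Units.val_neg, Units.val_one, smul_eq_mul, ← mul_assoc, ← pow_add]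
        simp
      rw [h2] at h
      simp only [Nat.cast_zero, Ring.choose_zero_right, one_smul, sub_zero, add_zero, zero_add, sub_add_cancel, creation_neg_one] at h
      simp only [zero_add] at h1
      rw [h1] at h
      simp only [canD]
      rw [h, show -1 - ((i + j : ℕ) : ℤ) = -1 - (j : ℤ) - i by push_cast; ring]
      simp
    · intro p hp
      rw [Finset.mem_range] at hp
      have h1 : nprod (k := k) (0 + (p : ℤ)) v (vac (k := k) : V) = 0 := creation_nonneg _ _ (by positivity)
      have h3 := canD_vac (k := k) (V := V) (i - p) (by omega)
      unfold canD at h3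
      rw [h1, show -1 - (i : ℤ) + p = -1 - ((i - p : ℕ) : ℤ) by omega, h3]
      simp
  · intro p hp
    have h1 : nprod (k := k) (0 + (p : ℤ)) v (vac (k := k) : V) = 0 := creation_nonneg _ _ (by positivity)
    have h2 : nprod (k := k) (-1 - (i : ℤ) + p) (vac (k := k) : V) (vac (k := k)) = 0 :=
      creation_nonneg _ _ (by omega)
    rw [h1, h2]; simp
  · intro p hp
    rw [Ring.choose_zero_pos _ (by omega)]
    simp

/-- The vacuum identity `Y(1, z) = id`. -/
lemma vac_nprod (n : ℤ) (v : V) : nprod (k := k) n (vac (k := k) : V) v = if n = -1 then v else 0 := by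
  rcases lt_or_ge n 0 with hn | hn
  · obtain ⟨m, rfl⟩ : ∃ m : ℕ, n = -1 - m := ⟨(-1 - n).toNat, by omega⟩
    rw [skew v (vac (k := k) : V) (-1 - m) (m + 1)
      (fun i hi => creation_nonneg _ _ (by omega))]
    have h1 : ∀ i ∈ Finset.range (m + 1), (-1 : ℤ) ^ i •
        nprod (k := k) (-1 - i) (nprod (k := k) (-1 - (m : ℤ) + i) v (vac (k := k))) (vac (k := k))
        = ((-1 : ℤ) ^ i * (m.choose i : ℤ)) • canD k m v := by
      intro i hi
      rw [Finset.mem_range] at hi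
      have h2 := canD_comp (k := k) i (m - i) v
      rw [show i + (m - i) = m by omega] at h2
      rw [mul_smul, natCast_zsmul, ← h2, show -1 - (m : ℤ) + i = -1 - ((m - i : ℕ) : ℤ) by omega]
      rfl
    rw [Finset.sum_congr rfl h1, ← Finset.sum_smul, Int.alternating_sum_range_choose]
    rcases Nat.eq_zero_or_pos m with rfl | hm
    · simp [canD, creation_neg_one]
    · rw [if_neg (by omega), if_neg (by omega)]; simp
  · rw [skew v (vac (k := k) : V) n 0 (fun i hi => creation_nonneg _ _ (by omega)), if_neg (by omega)]
    simp

end Basic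

section BaseChange

open HasseSchmidt

variable {k V S : Type*} [CommRing k] [AddCommGroup V] [Module k V] [VertexAlgebra k V]
  [CommRing S] [Algebra k S] [HasseSchmidt k S]

variable (k V S) in
/-- The bilinear map `(u ⊗ s, v ⊗ t) ↦ u_{n + j} v ⊗ D_j(s) t`. -/
noncomputable def tensorTerm (n : ℤ) (j : ℕ) : V ⊗[k] S →ₗ[k] V ⊗[k] S →ₗ[k] V ⊗[k] S :=
  TensorProduct.map₂ (nprod (k := k) (n + j)) ((LinearMap.mul k S).comp (D j))

@[simp]
lemma tensorTerm_tmul (n : ℤ) (j : ℕ) (u v : V) (s t : S) :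
    tensorTerm k V S n j (u ⊗ₜ s) (v ⊗ₜ t) =
      nprod (k := k) (n + j) u v ⊗ₜ[k] (D (k := k) j s * t) := rfl

lemma tensorTerm_bound (x y : V ⊗[k] S) :
    ∃ N : ℕ, ∀ (n : ℤ) (j : ℕ), (N : ℤ) ≤ n + j → tensorTerm k V S n j x y = 0 := by
  induction x using TensorProduct.induction_on with
  | zero => exact ⟨0, fun n j _ => by simp⟩
  | add x₁ x₂ h₁ h₂ =>
    obtain ⟨N₁, h₁⟩ := h₁
    obtain ⟨N₂, h₂⟩ := h₂
    exact ⟨N₁ + N₂, fun n j h => by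
      rw [map_add, LinearMap.add_apply, h₁ n j (by omega), h₂ n j (by omega), add_zero]⟩
  | tmul u s =>
    induction y using TensorProduct.induction_on with
    | zero => exact ⟨0, fun n j _ => by simp⟩
    | add y₁ y₂ h₁ h₂ =>
      obtain ⟨N₁, h₁⟩ := h₁
      obtain ⟨N₂, h₂⟩ := h₂
      exact ⟨N₁ + N₂, fun n j h => by
        rw [map_add, h₁ n j (by omega), h₂ n j (by omega), add_zero]⟩
    | tmul v t =>
      obtain ⟨N, hN⟩ := exists_bound k u v
      exact ⟨N, fun n j h => by rw [tensorTerm_tmul, hN _ h, TensorProduct.zero_tmul]⟩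

lemma tensorTerm_finite (n : ℤ) (x y : V ⊗[k] S) :
    (Function.support fun j => tensorTerm k V S n j x y).Finite := by
  obtain ⟨N, hN⟩ := tensorTerm_bound x y
  refine (Finset.range ((N : ℤ) - n).toNat).finite_toSet.subset fun j hj => ?_
  simp only [Finset.coe_range, Set.mem_Iio]
  by_contra hc
  exact hj (hN n j (by omega))

variable (k V S) in
/-- The `n`-th product on `V ⊗ S`, characterised by
`(u ⊗ s)_n (v ⊗ t) = ∑_{j ≥ 0} u_{n + j} v ⊗ D_j(s) t`. -/
noncomputable def tensorProd (n : ℤ) : V ⊗[k] S →ₗ[k] V ⊗[k] S →ₗ[k] V ⊗[k] S :=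
  LinearMap.mk₂ k (fun x y => ∑ᶠ j : ℕ, tensorTerm k V S n j x y)
    (fun x x' y => by
      simp only [map_add, LinearMap.add_apply]
      exact finsum_add_distrib (tensorTerm_finite n x y) (tensorTerm_finite n x' y))
    (fun c x y => by
      simp only [map_smul, LinearMap.smul_apply]
      exact (smul_finsum' c (tensorTerm_finite n x y)).symm)
    (fun x y y' => by
      simp only [map_add]
      exact finsum_add_distrib (tensorTerm_finite n x y) (tensorTerm_finite n x y'))
    (fun c x y => by
      simp only [map_smul]
      exact (smul_finsum' c (tensorTerm_finite n x y)).symm)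

lemma tensorProd_tmul (n : ℤ) (u v : V) (s t : S) :
    tensorProd k V S n (u ⊗ₜ s) (v ⊗ₜ t) =
      ∑ᶠ j : ℕ, nprod (k := k) (n + j) u v ⊗ₜ[k] (D (k := k) j s * t) := rfl

lemma tensorProd_tmul_range (n : ℤ) (u v : V) (s t : S) (K : ℕ)
    (h : ∀ j : ℕ, K ≤ j → nprod (k := k) (n + j) u v = 0) :
    tensorProd k V S n (u ⊗ₜ s) (v ⊗ₜ t) =
      ∑ j ∈ Finset.range K, nprod (k := k) (n + j) u v ⊗ₜ[k] (D (k := k) j s * t) := by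
  rw [tensorProd_tmul, finsum_eq_range _ K]
  intro j hj
  rw [h j hj, TensorProduct.zero_tmul]

lemma tensorProd_regular (x y : V ⊗[k] S) :
    ∃ N : ℕ, ∀ n : ℤ, (N : ℤ) ≤ n → tensorProd k V S n x y = 0 := by
  obtain ⟨N, hN⟩ := tensorTerm_bound x y
  refine ⟨N, fun n hn => ?_⟩
  change ∑ᶠ j : ℕ, tensorTerm k V S n j x y = 0
  rw [finsum_eq_range _ 0]
  · simp
  · intro j _; exact hN n j (by omega)

/-- Reindexing a truncated double sum over antidiagonals. -/
lemma sum_antidiag_range {A : Type*} [AddCommMonoid A] (K : ℕ) (f : ℕ → ℕ → A)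
    (h : ∀ q s, K ≤ q + s → f q s = 0) :
    ∑ p ∈ Finset.range K, ∑ x ∈ Finset.HasAntidiagonal.antidiagonal p, f x.1 x.2 =
      ∑ q ∈ Finset.range K, ∑ s ∈ Finset.range K, f q s := by
  simp only [Finset.Nat.sum_antidiagonal_eq_sum_range_succ f]
  rw [Finset.sum_range_diag_flip]
  refine Finset.sum_congr rfl fun q hq => ?_
  refine Finset.sum_subset (Finset.range_mono (Nat.sub_le _ _)) fun s _ hs => h q s ?_
  rw [Finset.mem_range] at hs
  omega

/-- Shifting the index of a truncated sum. -/
lemma sum_shift_range {A : Type*} [AddCommMonoid A] (K j : ℕ) (f : ℕ → A)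
    (h : ∀ q, K ≤ q → f q = 0) (h' : ∀ q, q < j → f q = 0) :
    ∑ q ∈ Finset.range K, f (q + j) = ∑ q ∈ Finset.range K, f q := by
  have h1 : ∑ q ∈ Finset.range (j + K), f q = ∑ q ∈ Finset.range K, f q := by
    symm
    refine Finset.sum_subset (Finset.range_mono (Nat.le_add_left _ _)) fun s _ hs => h s ?_
    rw [Finset.mem_range] at hs
    omega
  rw [← h1, Finset.sum_range_add, Finset.sum_eq_zero (s := Finset.range j), zero_add]
  · exact Finset.sum_congr rfl fun q _ => by rw [add_comm]
  · intro q hq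
    exact h' q (Finset.mem_range.mp hq)


lemma exists_uniform_bound (g : ℕ → ℤ → V) (h1 : ∀ I, ∃ N : ℕ, ∀ p : ℤ, (N : ℤ) ≤ p → g I p = 0)
    (h2 : ∃ A : ℕ, ∀ I, A ≤ I → ∀ p, g I p = 0) :
    ∃ P : ℕ, ∀ I p, (P : ℤ) ≤ p → g I p = 0 := by
  choose N hN using h1
  obtain ⟨A, hA⟩ := h2
  refine ⟨∑ I ∈ Finset.range A, N I, fun I p hp => ?_⟩
  rcases lt_or_ge I A with hI | hI
  · apply hN
    have := Finset.single_le_sum (f := N) (fun _ _ => Nat.zero_le _) (Finset.mem_range.mpr hI)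
    omega
  · exact hA I hI p

lemma exists_bound_shift (u v : V) (n : ℤ) :
    ∃ A : ℕ, ∀ I : ℕ, A ≤ I → nprod (k := k) (n + I) u v = 0 := by
  obtain ⟨N, hN⟩ := exists_bound k u v
  exact ⟨((N : ℤ) - n).toNat, fun I hI => hN _ (by omega)⟩

lemma tensor_lhs (u v w : V) (a b c : S) (l m n : ℤ) :
    ∃ N : ℕ, ∀ K, N ≤ K →
      ∑ i ∈ Finset.range K, Ring.choose m i • tensorProd k V S (m + n - i)
        (tensorProd k V S (l + i) (u ⊗ₜ a) (v ⊗ₜ b)) (w ⊗ₜ c) =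
      ∑ J ∈ Finset.range K, ∑ s ∈ Finset.range K, (∑ I ∈ Finset.range K,
        Ring.choose (m + J) I • nprod (k := k) (m + J + (n + s) - I)
          (nprod (k := k) (l + I) u v) w) ⊗ₜ[k] (D (k := k) J a * D (k := k) s b * c) := by
  obtain ⟨A, hA⟩ := exists_bound_shift (k := k) u v l
  obtain ⟨P, hP⟩ := exists_uniform_bound
    (fun I p => nprod (k := k) p (nprod (k := k) (l + I) u v) w) (fun I => exists_bound k _ _)
    ⟨A, fun I hI p => by simp [hA I hI]⟩
  refine ⟨A + P + (m + n).natAbs, fun K hK => ?_⟩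
  have key : ∀ (I : ℕ) (p : ℤ), (K : ℤ) ≤ p + I →
      nprod (k := k) (m + n + p) (nprod (k := k) (l + I) u v) w = 0 := by
    intro I p hp
    rcases lt_or_ge I A with hI | hI
    · exact hP I _ (by omega)
    · simp [hA I hI]
  set X : ℕ → ℤ → V := fun I p => nprod (k := k) (m + n + p) (nprod (k := k) (l + I) u v) w with hX
  have keyA : ∀ (I : ℕ) (p : ℤ), A ≤ I → X I p = 0 := fun I p hI => by simp [hX, hA I hI]
  set E : ℕ → ℕ → S := fun J s => D (k := k) J a * D (k := k) s b * c with hE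
  -- expand both products
  have step1 : ∀ i : ℕ, tensorProd k V S (m + n - i)
        (tensorProd k V S (l + i) (u ⊗ₜ a) (v ⊗ₜ b)) (w ⊗ₜ c) =
      ∑ j ∈ Finset.range K, ∑ q ∈ Finset.range K, ∑ s ∈ Finset.range K,
        ((q + j).choose j : ℤ) • (X (i + j) ((q + j : ℕ) + s - (i + j : ℕ)) ⊗ₜ[k] E (q + j) s) := by
    intro i
    rw [tensorProd_tmul_range _ _ _ _ _ K, map_sum, LinearMap.sum_apply]
    · refine Finset.sum_congr rfl fun j _ => ?_
      rw [tensorProd_tmul_range _ _ _ _ _ K, ← sum_antidiag_range]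
      · refine Finset.sum_congr rfl fun p _ => ?_
        rw [D_mul, Finset.sum_mul, TensorProduct.tmul_sum]
        refine Finset.sum_congr rfl fun x hx => ?_
        rw [Finset.HasAntidiagonal.mem_antidiagonal] at hx
        rw [D_comp, smul_mul_assoc, smul_mul_assoc, TensorProduct.tmul_smul, natCast_zsmul,
          ← Nat.choose_symm_add]
        subst hx
        simp only [hX, hE]
        rw [show m + n - (i : ℤ) + ((x.1 + x.2 : ℕ) : ℤ) =
            m + n + (((x.1 + j : ℕ) : ℤ) + x.2 - ((i + j : ℕ) : ℤ)) by push_cast; ring,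
          show l + (i : ℤ) + j = l + ((i + j : ℕ) : ℤ) by push_cast; ring]
      · intro q s hqs
        have : X (i + j) ((q + j : ℕ) + s - (i + j : ℕ)) = 0 := key _ _ (by omega)
        rw [this]; simp
      · intro p hp
        have := key (i + j) (-i + p - 0) (by omega)
        rw [show m + n - (i : ℤ) + p = m + n + (-i + p - 0) by ring,
          show l + (i : ℤ) + j = l + ((i + j : ℕ) : ℤ) by push_cast; ring]
        exact this
    · intro j hj
      rw [show l + (i : ℤ) + j = l + ((i + j : ℕ) : ℤ) by push_cast; ring]
      exact hA _ (by omega)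
  have step2 : ∀ i : ℕ, tensorProd k V S (m + n - i)
        (tensorProd k V S (l + i) (u ⊗ₜ a) (v ⊗ₜ b)) (w ⊗ₜ c) =
      ∑ j ∈ Finset.range K, ∑ J ∈ Finset.range K, ∑ s ∈ Finset.range K,
        (J.choose j : ℤ) • (X (i + j) (J + s - (i + j : ℕ)) ⊗ₜ[k] E J s) := by
    intro i
    rw [step1]
    refine Finset.sum_congr rfl fun j _ => ?_
    refine sum_shift_range K j (fun J => ∑ s ∈ Finset.range K,
        (J.choose j : ℤ) • (X (i + j) (J + s - (i + j : ℕ)) ⊗ₜ[k] E J s)) ?_ ?_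
    · intro J hJ
      refine Finset.sum_eq_zero fun s _ => ?_
      have : X (i + j) (J + s - (i + j : ℕ)) = 0 := key _ _ (by omega)
      rw [this]; simp
    · intro J hJ
      simp [Nat.choose_eq_zero_of_lt hJ]
  simp only [step2, Finset.smul_sum]
  calc _ = ∑ J ∈ Finset.range K, ∑ s ∈ Finset.range K, ∑ i ∈ Finset.range K,
        ∑ j ∈ Finset.range K, Ring.choose m i • (J.choose j : ℤ) •
          (X (i + j) (J + s - (i + j : ℕ)) ⊗ₜ[k] E J s) := by
        rw [Finset.sum_comm' (t' := Finset.range K) (s' := fun _ => Finset.range K) (by simp)]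
        rw [Finset.sum_congr rfl fun j _ => Finset.sum_comm]
        rw [Finset.sum_comm]
        refine Finset.sum_congr rfl fun J _ => ?_
        rw [Finset.sum_congr rfl fun j _ => Finset.sum_comm]
        rw [Finset.sum_comm]
        refine Finset.sum_congr rfl fun s _ => ?_
        rw [Finset.sum_comm]
    _ = _ := by
        refine Finset.sum_congr rfl fun J _ => Finset.sum_congr rfl fun s _ => ?_
        rw [← sum_antidiag_range K (fun i j => Ring.choose m i • (J.choose j : ℤ) •
          (X (i + j) (J + s - (i + j : ℕ)) ⊗ₜ[k] E J s)), TensorProduct.sum_tmul]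
        · refine Finset.sum_congr rfl fun I _ => ?_
          rw [Ring.add_choose_eq _ (Commute.all _ _), Finset.sum_smul, TensorProduct.sum_tmul]
          refine Finset.sum_congr rfl fun x hx => ?_
          rw [Finset.HasAntidiagonal.mem_antidiagonal] at hx
          subst hx
          rw [Ring.choose_natCast, mul_smul, TensorProduct.smul_tmul', TensorProduct.smul_tmul']
          simp only [hX]
          rw [show m + n + ((J : ℤ) + s - ((x.1 + x.2 : ℕ) : ℤ)) =
            m + J + (n + s) - ((x.1 + x.2 : ℕ) : ℤ) by ring]
        · intro i j hij
          simp [keyA (i + j) _ (by omega)]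

lemma tensor_rhs (u v w : V) (a b c : S) (l m n : ℤ) :
    ∃ N : ℕ, ∀ K, N ≤ K → ∀ i : ℕ,
      tensorProd k V S (m + l - i) (u ⊗ₜ a) (tensorProd k V S (n + i) (v ⊗ₜ b) (w ⊗ₜ c)) =
      ∑ s ∈ Finset.range K, ∑ J ∈ Finset.range K,
        nprod (k := k) (m + J + l - i) u (nprod (k := k) (n + s + i) v w) ⊗ₜ[k]
          (D (k := k) J a * D (k := k) s b * c) := by
  obtain ⟨A, hA⟩ := exists_bound_shift (k := k) v w n
  obtain ⟨P, hP⟩ := exists_uniform_bound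
    (fun I p => nprod (k := k) p u (nprod (k := k) (n + I) v w)) (fun I => exists_bound k _ _)
    ⟨A, fun I hI p => by simp [hA I hI]⟩
  refine ⟨A + P + (m + l).natAbs, fun K hK i => ?_⟩
  rw [tensorProd_tmul_range _ _ _ _ _ K, map_sum]
  · refine Finset.sum_congr rfl fun s _ => ?_
    rw [tensorProd_tmul_range _ _ _ _ _ K]
    · refine Finset.sum_congr rfl fun J _ => ?_
      rw [mul_assoc, show m + l - (i : ℤ) + J = m + J + l - i by ring,
        show n + (i : ℤ) + s = n + s + i by ring]
    · intro J hJ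
      rw [show n + (i : ℤ) + s = n + ((i + s : ℕ) : ℤ) by push_cast; ring]
      rcases lt_or_ge (i + s) A with hI | hI
      · exact hP (i + s) _ (by omega)
      · rw [hA (i + s) hI, map_zero]
  · intro s hs
    rw [show n + (i : ℤ) + s = n + ((i + s : ℕ) : ℤ) by push_cast; ring]
    exact hA _ (by omega)

lemma tensor_jacobi_range (x y z : V ⊗[k] S) (l m n : ℤ) :
    ∃ N : ℕ, ∀ K, N ≤ K →
      ∑ i ∈ Finset.range K, Ring.choose m i •
        tensorProd k V S (m + n - i) (tensorProd k V S (l + i) x y) z =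
      ∑ i ∈ Finset.range K, ((-1) ^ i * Ring.choose l i) •
        (tensorProd k V S (m + l - i) x (tensorProd k V S (n + i) y z) -
          (l.negOnePow : ℤ) • tensorProd k V S (n + l - i) y (tensorProd k V S (m + i) x z)) := by
  induction x using TensorProduct.induction_on with
  | zero => exact ⟨0, fun K _ => by simp⟩
  | add x₁ x₂ h₁ h₂ =>
    obtain ⟨N₁, h₁⟩ := h₁
    obtain ⟨N₂, h₂⟩ := h₂
    refine ⟨N₁ + N₂, fun K hK => ?_⟩
    have := congrArg₂ (· + ·) (h₁ K (by omega)) (h₂ K (by omega))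
    simp only [← Finset.sum_add_distrib, ← smul_add] at this
    simp only [map_add, LinearMap.add_apply]
    rw [this]
    refine Finset.sum_congr rfl fun i _ => ?_
    congr 1; rw [smul_add]; abel
  | tmul u a =>
  induction y using TensorProduct.induction_on with
  | zero => exact ⟨0, fun K _ => by simp⟩
  | add x₁ x₂ h₁ h₂ =>
    obtain ⟨N₁, h₁⟩ := h₁
    obtain ⟨N₂, h₂⟩ := h₂
    refine ⟨N₁ + N₂, fun K hK => ?_⟩
    have := congrArg₂ (· + ·) (h₁ K (by omega)) (h₂ K (by omega))
    simp only [← Finset.sum_add_distrib, ← smul_add] at this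
    simp only [map_add, LinearMap.add_apply]
    rw [this]
    refine Finset.sum_congr rfl fun i _ => ?_
    congr 1; rw [smul_add]; abel
  | tmul v b =>
  induction z using TensorProduct.induction_on with
  | zero => exact ⟨0, fun K _ => by simp⟩
  | add x₁ x₂ h₁ h₂ =>
    obtain ⟨N₁, h₁⟩ := h₁
    obtain ⟨N₂, h₂⟩ := h₂
    refine ⟨N₁ + N₂, fun K hK => ?_⟩
    have := congrArg₂ (· + ·) (h₁ K (by omega)) (h₂ K (by omega))
    simp only [← Finset.sum_add_distrib, ← smul_add] at this
    simp only [map_add]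
    rw [this]
    refine Finset.sum_congr rfl fun i _ => ?_
    congr 1; rw [smul_add]; abel
  | tmul w c =>
    obtain ⟨N₁, h₁⟩ := tensor_lhs (k := k) u v w a b c l m n
    obtain ⟨N₂, h₂⟩ := tensor_rhs (k := k) u v w a b c l m n
    obtain ⟨N₃, h₃⟩ := tensor_rhs (k := k) v u w b a c l n m
    obtain ⟨A₁, hA₁⟩ := exists_bound_shift (k := k) u v l
    obtain ⟨A₂, hA₂⟩ := exists_bound_shift (k := k) v w n
    obtain ⟨A₃, hA₃⟩ := exists_bound_shift (k := k) u w m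
    refine ⟨N₁ + N₂ + N₃ + A₁ + A₂ + A₃, fun K hK => ?_⟩
    rw [h₁ K (by omega)]
    have hJ : ∀ J s : ℕ, _ := fun J s => jacobi_range (k := k) u v w l (m + J) (n + s) K
      (fun i hi => hA₁ i (by omega))
      (fun i hi => by
        rw [show n + (s : ℤ) + i = n + ((s + i : ℕ) : ℤ) by push_cast; ring]
        exact hA₂ _ (by omega))
      (fun i hi => by
        rw [show m + (J : ℤ) + i = m + ((J + i : ℕ) : ℤ) by push_cast; ring]
        exact hA₃ _ (by omega))
    rw [Finset.sum_congr rfl fun J _ => Finset.sum_congr rfl fun s _ => by rw [hJ J s]]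
    simp only [h₂ K (by omega), h₃ K (by omega)]
    simp only [TensorProduct.sum_tmul]
    rw [Finset.sum_congr rfl fun J _ => Finset.sum_comm, Finset.sum_comm]
    refine Finset.sum_congr rfl fun i _ => ?_
    simp only [← TensorProduct.smul_tmul', ← Finset.smul_sum, TensorProduct.sub_tmul,
      Finset.sum_sub_distrib]
    congr 2
    · rw [Finset.sum_comm]
    · congr 1
      refine Finset.sum_congr rfl fun J _ => Finset.sum_congr rfl fun s _ => ?_
      rw [mul_comm (D (k := k) J a)]

/-- Base change `V ⊗ S` of a vertex algebra `V` over `k` along a commutative `k`-algebra `S` with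
iterative Hasse-Schmidt derivation. -/
noncomputable instance baseChange : VertexAlgebra k (V ⊗[k] S) where
  nprod := tensorProd k V S
  vac := vac (k := k) ⊗ₜ 1
  regular x y := by
    obtain ⟨N, hN⟩ := tensorProd_regular x y
    exact ⟨N, hN⟩
  creation_nonneg x n hn := by
    induction x using TensorProduct.induction_on with
    | zero => simp
    | add x₁ x₂ h₁ h₂ => rw [map_add, LinearMap.add_apply, h₁, h₂, add_zero]
    | tmul v s =>
      rw [tensorProd_tmul_range _ _ _ _ _ 0]
      · simp
      · intro j _; exact creation_nonneg _ _ (by omega)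
  creation_neg_one x := by
    induction x using TensorProduct.induction_on with
    | zero => simp
    | add x₁ x₂ h₁ h₂ => rw [map_add, LinearMap.add_apply, h₁, h₂]
    | tmul v s =>
      rw [tensorProd_tmul_range _ _ _ _ _ 1]
      · simp [creation_neg_one, D_zero]
      · intro j _; exact creation_nonneg _ _ (by omega)
  jacobi x y z l m n := by
    obtain ⟨N, hN⟩ := tensor_jacobi_range x y z l m n
    obtain ⟨N₁, hN₁⟩ := tensorProd_regular x y
    obtain ⟨N₂, hN₂⟩ := tensorProd_regular y z
    obtain ⟨N₃, hN₃⟩ := tensorProd_regular x z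
    have := hN (N + N₁ + N₂ + N₃ + l.natAbs + m.natAbs + n.natAbs) (by omega)
    rwa [← finsum_eq_range, ← finsum_eq_range] at this
    · intro i hi
      rw [hN₂ (n + i) (by omega), hN₃ (m + i) (by omega)]
      simp
    · intro i hi
      rw [hN₁ (l + i) (by omega)]
      simp

end BaseChange

section Algebras

variable {k V : Type*} [CommRing k] [AddCommGroup V] [Module k V] [VertexAlgebra k V]

/-- Membership in the centre: `v_n u = 0 = u_n v` for all `u` and all `n ≥ 0`. -/
def IsCentral (k : Type*) {V : Type*} [CommRing k] [AddCommGroup V] [Module k V]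
    [VertexAlgebra k V] (v : V) : Prop :=
  ∀ (u : V) (n : ℤ), 0 ≤ n → nprod (k := k) n v u = 0 ∧ nprod (k := k) n u v = 0

variable (k V) in
/-- Automorphisms of a vertex algebra over `k`. -/
structure Aut extends V ≃ₗ[k] V where
  map_nprod : ∀ (n : ℤ) (u v : V),
    toFun (nprod (k := k) n u v) = nprod (k := k) n (toFun u) (toFun v)
  map_vac : toFun (vac (k := k)) = vac (k := k)

/-- A submodule containing the vacuum and closed under all products is a vertex algebra. -/
@[reducible]
def ofSubmodule (p : Submodule k V) (h1 : vac (k := k) ∈ p)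
    (h2 : ∀ (n : ℤ), ∀ u ∈ p, ∀ v ∈ p, nprod (k := k) n u v ∈ p) : VertexAlgebra k p where
  nprod n := LinearMap.mk₂ k
    (fun u v => (⟨nprod (k := k) n (u : V) (v : V), h2 n u u.2 v v.2⟩ : p))
    (fun _ _ _ => Subtype.ext (by simp)) (fun _ _ _ => Subtype.ext (by simp))
    (fun _ _ _ => Subtype.ext (by simp)) (fun _ _ _ => Subtype.ext (by simp))
  vac := ⟨vac (k := k), h1⟩
  regular u v := by
    obtain ⟨N, hN⟩ := regular (k := k) (u : V) v
    exact ⟨N, fun n hn => Subtype.ext (hN n hn)⟩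
  creation_nonneg v n hn := Subtype.ext (creation_nonneg (k := k) (v : V) n hn)
  creation_neg_one v := Subtype.ext (creation_neg_one (k := k) (v : V))
  jacobi u v w l m n := by
    apply p.subtype_injective
    have e := fun f : ℕ → p =>
      p.subtype.toAddMonoidHom.map_finsum_of_injective p.subtype_injective f
    simp only [LinearMap.toAddMonoidHom_coe] at e
    rw [e, e]
    simpa using jacobi (k := k) (u : V) v w l m n

end Algebras

/-- The structure on a vertex algebra `V` over `k` of a vertex algebra over the commutative vertex
ring `R` given by a `k`-algebra with Hasse-Schmidt derivation: a homomorphism `ι : R → V` of vertex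
rings with values in the centre of `V`. -/
class OverBase (k R V : Type*) [CommRing k] [CommRing R] [Algebra k R] [HasseSchmidt k R]
    [AddCommGroup V] [Module k V] [VertexAlgebra k V] where
  ι : R →ₗ[k] V
  ι_one : ι 1 = vac (k := k)
  ι_nprod : ∀ (n : ℤ) (r s : R),
    ι (HasseSchmidt.nprod k n r s) = nprod (k := k) n (ι r) (ι s)
  ι_central : ∀ r : R, IsCentral k (ι r)

/-- Homomorphisms of vertex algebras over `R`: homomorphisms of vertex rings (additive maps
preserving all products and the vacuum) that commute with the structure maps from `R`. -/
structure OverBase.Hom (k R V W : Type*) [CommRing k] [CommRing R] [Algebra k R] [HasseSchmidt k R]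
    [AddCommGroup V] [Module k V] [VertexAlgebra k V] [OverBase k R V]
    [AddCommGroup W] [Module k W] [VertexAlgebra k W] [OverBase k R W] extends V →+ W where
  map_nprod : ∀ (n : ℤ) (u v : V),
    toFun (nprod (k := k) n u v) = nprod (k := k) n (toFun u) (toFun v)
  map_vac : toFun (vac (k := k)) = vac (k := k)
  map_ι : ∀ r : R, toFun (OverBase.ι (k := k) r) = OverBase.ι (k := k) r

end VertexAlgebra

/-- The ring `k[t^{±1/M}]`: Laurent polynomials in `t^{1/M}`. -/
def RootLaurent (k : Type*) [Field k] (_M : ℕ) : Type _ := LaurentPolynomial k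

namespace RootLaurent

variable {k : Type*} [Field k]

noncomputable instance (M : ℕ) : CommRing (RootLaurent k M) :=
  inferInstanceAs (CommRing (LaurentPolynomial k))

noncomputable instance (M : ℕ) : Algebra k (RootLaurent k M) :=
  inferInstanceAs (Algebra k (LaurentPolynomial k))

/-- The monomial `t^{a/M}`. -/
noncomputable def t (M : ℕ) (a : ℤ) : RootLaurent k M := (LaurentPolynomial.T a : LaurentPolynomial k)

variable (k) in
/-- The basis of monomials `t^{a/M}`, `a ∈ ℤ`. -/
noncomputable def basis (M : ℕ) : Module.Basis ℤ k (RootLaurent k M) :=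
  (AddMonoidAlgebra.basis ℤ k : Module.Basis ℤ k (LaurentPolynomial k))

@[simp] lemma basis_apply (M : ℕ) (a : ℤ) : basis k M a = t M a :=
  AddMonoidAlgebra.basis_apply k a

lemma t_add (M : ℕ) (a b : ℤ) : (t M (a + b) : RootLaurent k M) = t M a * t M b :=
  LaurentPolynomial.T_add a b

lemma t_zero (M : ℕ) : (t M 0 : RootLaurent k M) = 1 := LaurentPolynomial.T_zero

/-- The algebra map `k[t^{±1/M}] → A` attached to the images of the monomials `t^{a/M}`. -/
noncomputable def liftHom {A : Type*} [CommRing A] [Algebra k A] (M : ℕ) (f : ℤ → A)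
    (h0 : f 0 = 1) (hadd : ∀ a b, f (a + b) = f a * f b) : RootLaurent k M →ₐ[k] A :=
  (AddMonoidAlgebra.lift k A ℤ
    { toFun := fun a => f a.toAdd, map_one' := h0, map_mul' := fun a b => hadd _ _ } :
      LaurentPolynomial k →ₐ[k] A)

@[simp] lemma liftHom_t {A : Type*} [CommRing A] [Algebra k A] (M : ℕ) (f : ℤ → A)
    (h0 : f 0 = 1) (hadd : ∀ a b, f (a + b) = f a * f b) (a : ℤ) :
    liftHom (k := k) M f h0 hadd (t M a) = f a := by
  unfold liftHom t LaurentPolynomial.T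
  exact (AddMonoidAlgebra.lift_single _ _ _).trans (one_smul k _)

/-- The automorphism `γ` of `k[t^{±1/M}]` with `t^{1/M} ↦ ζ t^{1/M}`. -/
noncomputable def galois {M : ℕ} [NeZero M] {ζ : k} (hζ : IsPrimitiveRoot ζ M) :
    RootLaurent k M →ₐ[k] RootLaurent k M :=
  liftHom M (fun a => ζ ^ a • t M a) (by simp [t_zero]) (fun a b => by
    rw [zpow_add₀ (hζ.ne_zero (NeZero.ne M)), t_add, smul_mul_smul_comm])

/-- The inclusion `k[t^{±1}] → k[t^{±1/M}]`. -/
noncomputable def incl (M : ℕ) : RootLaurent k 1 →ₐ[k] RootLaurent k M :=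
  liftHom 1 (fun a => t M (M * a)) (by simp [t_zero]) (fun _ _ => by rw [mul_add, t_add])

variable [CharZero k]

/-- The divided power `D_j` of `d/dt`: `D_j (t^q) = (q choose j) t^{q - j}`, where `q = a/M`. -/
noncomputable def divD (M : ℕ) (j : ℕ) : RootLaurent k M →ₗ[k] RootLaurent k M :=
  (basis k M).constr k fun a => Ring.choose ((a : k) / (M : k)) j • t M (a - j * M)

@[simp] lemma divD_t (M : ℕ) (j : ℕ) (a : ℤ) :
    divD M j (t M a : RootLaurent k M) = Ring.choose ((a : k) / (M : k)) j • t M (a - j * M) := by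
  rw [← basis_apply, divD, Module.Basis.constr_basis]

noncomputable instance (M : ℕ) [NeZero M] : HasseSchmidt k (RootLaurent k M) where
  D := divD M
  D_zero s := by
    suffices h : divD M 0 = (LinearMap.id : RootLaurent k M →ₗ[k] RootLaurent k M) by rw [h]; rfl
    refine (basis k M).ext fun a => ?_
    simp
  D_mul n s t' := by
    suffices h : (LinearMap.mul k (RootLaurent k M)).compr₂ (divD M n) =
        ∑ p ∈ Finset.HasAntidiagonal.antidiagonal n,
          (LinearMap.mul k (RootLaurent k M)).compl₁₂ (divD M p.1) (divD M p.2) by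
      have := LinearMap.congr_fun₂ h s t'
      simpa [LinearMap.sum_apply] using this
    refine (basis k M).ext fun a => (basis k M).ext fun b => ?_
    simp only [basis_apply, LinearMap.compr₂_apply, LinearMap.mul_apply', LinearMap.sum_apply,
      LinearMap.compl₁₂_apply, divD_t, ← t_add]
    rw [Int.cast_add, add_div, Ring.add_choose_eq _ (Commute.all _ _), Finset.sum_smul]
    refine Finset.sum_congr rfl fun p hp => ?_
    rw [Finset.HasAntidiagonal.mem_antidiagonal] at hp
    subst hp
    rw [smul_mul_smul_comm, ← t_add]
    congr 2
    push_cast; ring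
  D_comp i j s := by
    suffices h : divD M i ∘ₗ divD M j = (i + j).choose i • divD (k := k) M (i + j) by
      exact LinearMap.congr_fun h s
    refine (basis k M).ext fun a => ?_
    have hM : (M : k) ≠ 0 := Nat.cast_ne_zero.mpr (NeZero.ne M)
    have hc := Ring.choose_smul_choose ((a : k) / (M : k)) (Nat.le_add_left j i)
    rw [nsmul_eq_mul] at hc
    simp only [basis_apply, LinearMap.comp_apply, divD_t, map_smul, LinearMap.smul_apply,
      smul_smul]
    rw [Nat.choose_symm_add, ← Nat.cast_smul_eq_nsmul k, smul_smul, hc]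
    congr 2
    · congr 2
      · push_cast; field_simp
      · omega
    · push_cast; ring

lemma D_t (M : ℕ) [NeZero M] (j : ℕ) (a : ℤ) :
    HasseSchmidt.D (k := k) j (t M a : RootLaurent k M) =
      Ring.choose ((a : k) / (M : k)) j • t M (a - j * M) := divD_t M j a

lemma D_galois {M : ℕ} [NeZero M] {ζ : k} (hζ : IsPrimitiveRoot ζ M) (j : ℕ)
    (s : RootLaurent k M) :
    galois hζ (HasseSchmidt.D (k := k) j s) = HasseSchmidt.D (k := k) j (galois hζ s) := by
  suffices h : (galois hζ).toLinearMap ∘ₗ HasseSchmidt.D (k := k) j =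
      HasseSchmidt.D (k := k) j ∘ₗ (galois hζ).toLinearMap from LinearMap.congr_fun h s
  refine (basis k M).ext fun a => ?_
  have : ζ ^ (a - j * M) = ζ ^ a := by
    rw [zpow_sub₀ (hζ.ne_zero (NeZero.ne M)), mul_comm (j : ℤ), zpow_mul, zpow_natCast ζ M,
      hζ.pow_eq_one, one_zpow, div_one]
  simp only [galois, basis_apply, LinearMap.comp_apply, AlgHom.toLinearMap_apply, D_t, map_smul,
    liftHom_t, this]
  rw [smul_comm]

lemma D_incl (M : ℕ) [NeZero M] (j : ℕ) (s : RootLaurent k 1) :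
    incl M (HasseSchmidt.D (k := k) j s) = HasseSchmidt.D (k := k) j (incl M s) := by
  suffices h : (incl M).toLinearMap ∘ₗ HasseSchmidt.D (k := k) j =
      HasseSchmidt.D (k := k) j ∘ₗ (incl (k := k) M).toLinearMap from LinearMap.congr_fun h s
  refine (basis k 1).ext fun a => ?_
  have hM : (M : k) ≠ 0 := Nat.cast_ne_zero.mpr (NeZero.ne M)
  simp only [basis_apply, LinearMap.comp_apply, AlgHom.toLinearMap_apply, D_t, map_smul, incl,
    liftHom_t]
  congr 2
  · push_cast; field_simp
  · push_cast; ring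

lemma galois_incl {M : ℕ} [NeZero M] {ζ : k} (hζ : IsPrimitiveRoot ζ M) (s : RootLaurent k 1) :
    galois hζ (incl M s) = incl M s := by
  suffices h : (galois hζ).toLinearMap ∘ₗ (incl M).toLinearMap = (incl (k := k) M).toLinearMap from
    LinearMap.congr_fun h s
  refine (basis k 1).ext fun a => ?_
  have : ζ ^ ((M : ℤ) * a) = 1 := by rw [zpow_mul, zpow_natCast, hζ.pow_eq_one, one_zpow]
  simp [galois, incl, this]

end RootLaurent

namespace VertexAlgebra

section Loop

variable {k V : Type*} [Field k] [CharZero k] [AddCommGroup V] [Module k V] [VertexAlgebra k V]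
  {M : ℕ} [NeZero M] {ζ : k}

/-- The map `g ⊗ γ` on `V ⊗ k[t^{±1/M}]`. -/
noncomputable def loopAut (g : Aut k V) (hζ : IsPrimitiveRoot ζ M) :
    V ⊗[k] RootLaurent k M →ₗ[k] V ⊗[k] RootLaurent k M :=
  TensorProduct.map g.toLinearEquiv.toLinearMap (RootLaurent.galois hζ).toLinearMap

lemma loopAut_tmul (g : Aut k V) (hζ : IsPrimitiveRoot ζ M) (v : V) (s : RootLaurent k M) :
    loopAut g hζ (v ⊗ₜ s) = g.toLinearEquiv v ⊗ₜ RootLaurent.galois hζ s := rfl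

lemma loopAut_nprod (g : Aut k V) (hζ : IsPrimitiveRoot ζ M) (n : ℤ)
    (x y : V ⊗[k] RootLaurent k M) :
    loopAut g hζ (nprod (k := k) n x y) = nprod (k := k) n (loopAut g hζ x) (loopAut g hζ y) := by
  induction x using TensorProduct.induction_on with
  | zero => simp
  | add x₁ x₂ h₁ h₂ => simp only [map_add, LinearMap.add_apply, h₁, h₂]
  | tmul u s =>
  induction y using TensorProduct.induction_on with
  | zero => simp
  | add x₁ x₂ h₁ h₂ => simp only [map_add, h₁, h₂]
  | tmul v t =>
    obtain ⟨K, hK⟩ := exists_bound_shift (k := k) u v n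
    have hg : ∀ (m : ℤ) (a b : V), g.toLinearEquiv (nprod (k := k) m a b) =
      nprod (k := k) m (g.toLinearEquiv a) (g.toLinearEquiv b) := g.map_nprod
    change loopAut g hζ (tensorProd k V _ n _ _) = tensorProd k V _ n _ _
    rw [loopAut_tmul, loopAut_tmul, tensorProd_tmul_range _ _ _ _ _ K hK,
      tensorProd_tmul_range _ _ _ _ _ K (fun j hj => by rw [← hg, hK j hj, map_zero]), map_sum]
    refine Finset.sum_congr rfl fun j _ => ?_
    rw [loopAut_tmul, hg, map_mul, RootLaurent.D_galois]

/-- The twisted loop vertex algebra `L(V, g)`: the fixed points of `g ⊗ γ` on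
`V ⊗ k[t^{±1/M}]`. -/
noncomputable def Loop (g : Aut k V) (hζ : IsPrimitiveRoot ζ M) :
    Submodule k (V ⊗[k] RootLaurent k M) :=
  LinearMap.eqLocus (loopAut g hζ) LinearMap.id

lemma mem_Loop (g : Aut k V) (hζ : IsPrimitiveRoot ζ M) (x : V ⊗[k] RootLaurent k M) :
    x ∈ Loop g hζ ↔ loopAut g hζ x = x := Iff.rfl

lemma one_tmul_mem_Loop (g : Aut k V) (hζ : IsPrimitiveRoot ζ M) (r : RootLaurent k 1) :
    (vac (k := k) : V) ⊗ₜ[k] RootLaurent.incl M r ∈ Loop g hζ := by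
  have hg : g.toLinearEquiv (vac (k := k)) = vac (k := k) := g.map_vac
  rw [mem_Loop, loopAut_tmul, RootLaurent.galois_incl, hg]

noncomputable instance (g : Aut k V) (hζ : IsPrimitiveRoot ζ M) : VertexAlgebra k (Loop g hζ) :=
  ofSubmodule (Loop g hζ)
    (by
      have := one_tmul_mem_Loop g hζ 1
      rw [map_one] at this
      exact this)
    (fun n x hx y hy => by
      rw [mem_Loop] at *
      rw [loopAut_nprod, hx, hy])

lemma coe_nprod (g : Aut k V) (hζ : IsPrimitiveRoot ζ M) (n : ℤ) (x y : Loop g hζ) :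
    ((nprod (k := k) n x y : Loop g hζ) : V ⊗[k] RootLaurent k M) =
      nprod (k := k) n (x : V ⊗[k] RootLaurent k M) (y : V ⊗[k] RootLaurent k M) := rfl

lemma isCentral_one_tmul (s : RootLaurent k M) :
    IsCentral k ((vac (k := k) : V) ⊗ₜ[k] s) := by
  intro y n hn
  induction y using TensorProduct.induction_on with
  | zero => simp
  | add y₁ y₂ h₁ h₂ => simp [h₁, h₂]
  | tmul v t =>
    constructor
    · refine (tensorProd_tmul_range _ _ _ _ _ 0 fun j _ => ?_).trans (by simp)
      rw [vac_nprod, if_neg (by omega)]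
    · refine (tensorProd_tmul_range _ _ _ _ _ 0 fun j _ => ?_).trans (by simp)
      exact creation_nonneg _ _ (by omega)

/-- The structure of a `k[t^{±1}]`-vertex algebra on `L(V, g)`, given by `r ↦ 1 ⊗ r`. -/
noncomputable instance (g : Aut k V) (hζ : IsPrimitiveRoot ζ M) :
    OverBase k (RootLaurent k 1) (Loop g hζ) where
  ι := LinearMap.codRestrict (Loop g hζ)
    ((TensorProduct.mk k V (RootLaurent k M) (vac (k := k))).comp (RootLaurent.incl M).toLinearMap)
    (one_tmul_mem_Loop g hζ)
  ι_one := Subtype.ext (by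
    change (vac (k := k) : V) ⊗ₜ[k] RootLaurent.incl M 1 = (vac (k := k) : V) ⊗ₜ[k] 1
    rw [map_one])
  ι_nprod n r s := Subtype.ext (by
    change (vac (k := k) : V) ⊗ₜ[k] RootLaurent.incl M (HasseSchmidt.nprod k n r s) =
      tensorProd k V _ n (vac (k := k) ⊗ₜ RootLaurent.incl M r)
        (vac (k := k) ⊗ₜ RootLaurent.incl M s)
    unfold HasseSchmidt.nprod
    rcases lt_or_ge n 0 with hn | hn
    · obtain ⟨m, rfl⟩ : ∃ m : ℕ, n = -1 - m := ⟨(-1 - n).toNat, by omega⟩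
      rw [if_pos hn, tensorProd_tmul_range _ _ _ _ _ (m + 1), Finset.sum_range_succ,
        Finset.sum_eq_zero]
      · rw [vac_nprod, if_pos (by omega), map_mul, RootLaurent.D_incl, zero_add,
          show (-(-1 - (m : ℤ)) - 1).toNat = m by omega]
      · intro j hj
        rw [Finset.mem_range] at hj
        rw [vac_nprod, if_neg (by omega), TensorProduct.zero_tmul]
      · intro j hj
        rw [vac_nprod, if_neg (by omega)]
    · rw [if_neg (by omega), tensorProd_tmul_range _ _ _ _ _ 0]
      · simp
      · intro j hj
        rw [vac_nprod, if_neg (by omega)])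
  ι_central r y n hn :=
    ⟨Subtype.ext (isCentral_one_tmul (RootLaurent.incl M r) (y : V ⊗[k] RootLaurent k M) n hn).1,
      Subtype.ext (isCentral_one_tmul (RootLaurent.incl M r) (y : V ⊗[k] RootLaurent k M) n hn).2⟩

/-- The eigenspace `V^{g,a} = {v | g v = ζ^{-a} v}`; it depends only on `a` modulo `M`. -/
noncomputable def eigen (g : Aut k V) (ζ : k) (a : ℤ) : Submodule k V :=
  Module.End.eigenspace g.toLinearEquiv.toLinearMap (ζ ^ (-a))

lemma tmul_t_mem_Loop (g : Aut k V) (hζ : IsPrimitiveRoot ζ M) (a : ℤ) (v : eigen g ζ a) :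
    (v : V) ⊗ₜ[k] RootLaurent.t M a ∈ Loop g hζ := by
  have hv : g.toLinearEquiv (v : V) = ζ ^ (-a) • (v : V) := Module.End.mem_eigenspace_iff.mp v.2
  have h1 : ζ ^ (-a) * ζ ^ a = 1 := by
    rw [← zpow_add₀ (hζ.ne_zero (NeZero.ne M)), neg_add_cancel, zpow_zero]
  rw [mem_Loop, loopAut_tmul, hv, RootLaurent.galois, RootLaurent.liftHom_t,
    TensorProduct.smul_tmul_smul, h1, one_smul]

/-- The element `v_{(n)} = v ⊗ t^n` of `L(V, g)`, for `n = a/M` and `v ∈ V^{g,a}`. -/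
noncomputable def loopElt (g : Aut k V) (hζ : IsPrimitiveRoot ζ M) (a : ℤ) (v : eigen g ζ a) :
    Loop g hζ :=
  ⟨(v : V) ⊗ₜ[k] RootLaurent.t M a, tmul_t_mem_Loop g hζ a v⟩

variable {W : Type*} [AddCommGroup W] [Module k W]

/-- `IsWeakTwistedModule g M ζ Y` says that `Y` makes `W` into a weak `g`-twisted `V`-module. Here
`g` has period `M`, `ζ` is a primitive `M`-th root of unity, and `Y a v` stands for the coefficient
`v_n`, `n = a/M`, of `z ^ (-n - 1)` in `Y_W(v, z) = ∑_{n ∈ (1/M)ℤ} v_n z ^ (-n - 1)`. The Jacobi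
identity is written out in coefficients; its left-hand side comes from the expansion of
`z₂⁻¹ ((z₁ - z₀) / z₂) ^ (-r/M) δ ((z₁ - z₀) / z₂) Y_W(Y(u, z₀) v, z₂)` for `u ∈ V^{g,r}`. -/
structure IsWeakTwistedModule (g : Aut k V) (M : ℕ) (ζ : k) (Y : ℤ → V →ₗ[k] Module.End k W) :
    Prop where
  /-- `Y_W(v, z) = ∑_{n ∈ r/M + ℤ} v_n z ^ (-n - 1)` for `v ∈ V^{g,r}`. -/
  support : ∀ (r a : ℤ), ∀ v ∈ eigen g ζ r, ¬ a ≡ r [ZMOD M] → Y a v = 0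
  /-- `v_n w = 0` for `n` large. -/
  regular : ∀ (v : V) (w : W), ∃ N : ℤ, ∀ a : ℤ, N ≤ a → Y a v w = 0
  /-- `Y_W(1, z) = id`. -/
  vacuum : ∀ a : ℤ, Y a (vac (k := k)) = if a = -M then 1 else 0
  jacobi : ∀ (a b l : ℤ), ∀ u ∈ eigen g ζ a, ∀ (v : V) (w : W),
    ∑ᶠ i : ℕ, Ring.choose ((a : k) / (M : k)) i •
      Y (a + b - i * M) (nprod (k := k) (l + i) u v) w =
    ∑ᶠ i : ℕ, ((-1) ^ i * Ring.choose l i) •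
      (Y (a + (l - i) * M) u (Y (b + i * M) v w) -
        (l.negOnePow : ℤ) • Y (b + (l - i) * M) v (Y (a + i * M) u w))

/-- The linear map `L(V, h) → End W` with `v_{(n)} ↦ v_n`. -/
noncomputable def modeMap (h : Aut k V) (hζ : IsPrimitiveRoot ζ M)
    (Y : ℤ → V →ₗ[k] Module.End k W) : Loop h hζ →ₗ[k] Module.End k W :=
  (TensorProduct.lift ((RootLaurent.basis k M).constr k Y).flip).comp (Loop h hζ).subtype

/-- `modeMap` sends `v_{(n)}` to `v_n`. -/
lemma modeMap_loopElt (h : Aut k V) (hζ : IsPrimitiveRoot ζ M) (Y : ℤ → V →ₗ[k] Module.End k W)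
    (a : ℤ) (v : eigen h ζ a) : modeMap h hζ Y (loopElt h hζ a v) = Y a v := by
  simp only [modeMap, loopElt, LinearMap.comp_apply, Submodule.subtype_apply,
    TensorProduct.lift.tmul, LinearMap.flip_apply, ← RootLaurent.basis_apply,
    Module.Basis.constr_basis]

/-- `IsPullback φ Y Y'` says that `Y'` is `φ^* Y`, that is
`Y'(v, z) = ∑_{n ∈ r/M + ℤ} φ̄(v_{(n)}) z ^ (-n - 1)` for `v ∈ V^{g,r}`, where `φ̄` is the composite
of `φ : L(V, g) → L(V, h)` with `L(V, h) → End W`, `v_{(n)} ↦ v_n`. -/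
structure IsPullback {g h : Aut k V} {hζ : IsPrimitiveRoot ζ M}
    (φ : OverBase.Hom k (RootLaurent k 1) (Loop g hζ) (Loop h hζ))
    (Y Y' : ℤ → V →ₗ[k] Module.End k W) : Prop where
  mode : ∀ (a : ℤ) (v : eigen g ζ a),
    Y' a v = modeMap h hζ Y (φ.toAddMonoidHom (loopElt g hζ a v))
  support : ∀ (r a : ℤ), ∀ v ∈ eigen g ζ r, ¬ a ≡ r [ZMOD M] → Y' a v = 0

end Loop
end VertexAlgebra

/-!
A weak `g`-twisted `V`-module is the same thing as a module over the vertex algebra `L(V, g)` on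
which `t` acts as the formal variable `z`: the vertex operator of `v_{(n)} = v ⊗ t ^ n` is
`z ^ n Y_W(v, z)`, so that its residue is the mode `v_n`, and the twisting factor in the Jacobi
identity is produced by the derivatives of `t ^ n` in the products of `L(V, g)`. Modules of the
latter kind can be pulled back along any map of vertex algebras over `k[t^{±1}]`.

To pass between the two notions, note that the coefficient of `t ^ (a / M)` in a fixed point of
`g ⊗ γ` lies in `V^{g,a}`, so that `L(V, g)` is spanned by the `v_{(n)}`, and that averaging over
the powers of `ζ ^ a g` projects `V` onto `V^{g,a}`, so that `V` is the sum of the `V^{g,a}`.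
-/

namespace RootLaurent

variable {k : Type*} [Field k] {M : ℕ}

lemma galois_t [NeZero M] {ζ : k} (hζ : IsPrimitiveRoot ζ M) (a : ℤ) :
    galois hζ (t M a) = ζ ^ a • t M a := by
  rw [galois, liftHom_t]

variable (M) in
lemma incl_t (q : ℤ) : incl M (t 1 q : RootLaurent k 1) = t M (q * M) := by
  rw [incl, liftHom_t, mul_comm]

end RootLaurent

namespace VertexAlgebra

section Average

variable {k U U' : Type*} [Field k] [AddCommGroup U] [Module k U] [AddCommGroup U'] [Module k U']

/-- The mean of the first `M` powers of an endomorphism. If `A ^ M = 1`, it is the projection onto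
the fixed points of `A`. -/
noncomputable def average (M : ℕ) (A : Module.End k U) : Module.End k U :=
  (M : k)⁻¹ • ∑ j ∈ Finset.range M, A ^ j

lemma average_apply (M : ℕ) (A : Module.End k U) (x : U) :
    average M A x = (M : k)⁻¹ • ∑ j ∈ Finset.range M, (A ^ j) x := by
  simp only [average, LinearMap.smul_apply, LinearMap.sum_apply]

lemma mul_average {M : ℕ} {A : Module.End k U} (hA : A ^ M = 1) :
    A * average M A = average M A := by
  have h := mul_geom_sum A M
  rw [hA, sub_self, sub_mul, one_mul, sub_eq_zero] at h
  rw [average, mul_smul_comm, h]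

lemma average_apply_eq_self [CharZero k] {M : ℕ} [NeZero M] {A : Module.End k U} {x : U}
    (hx : A x = x) : average M A x = x := by
  have hpow (j : ℕ) : (A ^ j) x = x := by
    rw [Module.End.pow_apply, Function.iterate_fixed hx]
  have hM : (M : k) ≠ 0 := Nat.cast_ne_zero.mpr (NeZero.ne M)
  simp only [average_apply, hpow, Finset.sum_const, Finset.card_range]
  rw [← Nat.cast_smul_eq_nsmul k, inv_smul_smul₀ hM]

lemma average_apply_eq_zero {M : ℕ} {A : Module.End k U} {x : U} {c : k} (hx : A x = c • x)
    (hc : c ^ M = 1) (hc1 : c ≠ 1) : average M A x = 0 := by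
  have hpow (j : ℕ) : (A ^ j) x = c ^ j • x := by
    induction j with
    | zero => simp only [pow_zero, Module.End.one_apply, one_smul]
    | succ j ih => rw [pow_succ', Module.End.mul_apply, ih, map_smul, hx, smul_smul, pow_succ]
  simp only [average_apply, hpow]
  rw [← Finset.sum_smul, geom_sum_eq hc1, hc, sub_self, zero_div, zero_smul, smul_zero]

lemma average_comp_of_comp_eq {A : Module.End k U} {A' : Module.End k U'} {B : U →ₗ[k] U'}
    (h : A' ∘ₗ B = B ∘ₗ A) (M : ℕ) : average M A' ∘ₗ B = B ∘ₗ average M A := by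
  ext x
  simp only [LinearMap.comp_apply, average_apply, map_smul, map_sum]
  congr 1
  exact Finset.sum_congr rfl fun j _ =>
    LinearMap.congr_fun (Module.End.commute_pow_left_of_commute h j) x

/-- Only the zeroth powers of `ζ ^ s • A` survive, since `∑ s, (ζ ^ j) ^ s = 0` for `0 < j < M`. -/
lemma sum_average_smul [CharZero k] {M : ℕ} [NeZero M] {ζ : k} (hζ : IsPrimitiveRoot ζ M)
    (A : Module.End k U) : ∑ s ∈ Finset.range M, average M (ζ ^ s • A) = 1 := by
  have hM : (M : k) ≠ 0 := Nat.cast_ne_zero.mpr (NeZero.ne M)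
  have hvanish : ∀ j ∈ Finset.range M, j ≠ 0 → ∑ s ∈ Finset.range M, (ζ ^ s • A) ^ j = 0 := by
    intro j hj hj0
    have hne : ζ ^ j ≠ 1 := hζ.pow_ne_one_of_pos_of_lt hj0 (Finset.mem_range.mp hj)
    simp only [smul_pow, pow_right_comm ζ _ j]
    rw [← Finset.sum_smul, geom_sum_eq hne, pow_right_comm, hζ.pow_eq_one, one_pow, sub_self,
      zero_div, zero_smul]
  simp only [average, ← Finset.smul_sum]
  rw [Finset.sum_comm, Finset.sum_eq_single_of_mem 0 (Finset.mem_range.mpr (NeZero.pos M)) hvanish]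
  simp only [pow_zero, Finset.sum_const, Finset.card_range]
  rw [← Nat.cast_smul_eq_nsmul k, inv_smul_smul₀ hM]

end Average

section OverBase

variable {k R V W : Type*} [CommRing k] [CommRing R] [Algebra k R] [HasseSchmidt k R]
  [AddCommGroup V] [Module k V] [VertexAlgebra k V] [OverBase k R V]
  [AddCommGroup W] [Module k W] [VertexAlgebra k W] [OverBase k R W]

variable (k V) in
/-- The action of the base `R` on a vertex algebra over `R`: `r` acts as the product
`x ↦ ι(r)_{-1} x`. -/
def OverBase.action (r : R) : Module.End k V := nprod (k := k) (-1) (OverBase.ι (k := k) r)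

lemma OverBase.action_smul_one (c : k) (x : V) :
    OverBase.action k V (c • (1 : R)) x = c • x := by
  rw [action, map_smul, OverBase.ι_one, map_smul, LinearMap.smul_apply, vac_nprod, if_pos rfl]

lemma OverBase.Hom.map_action (φ : OverBase.Hom k R V W) (r : R) (x : V) :
    φ.toAddMonoidHom (action k V r x) = action k W r (φ.toAddMonoidHom x) :=
  (φ.map_nprod (-1) (ι (k := k) r) x).trans (by rw [φ.map_ι]; rfl)

/-- A homomorphism of vertex algebras over `R`, as a `k`-linear map. -/
def OverBase.Hom.toLinearMap (φ : OverBase.Hom k R V W) : V →ₗ[k] W where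
  toFun := φ.toAddMonoidHom
  map_add' := φ.toAddMonoidHom.map_add
  map_smul' c x := by
    have h := φ.map_action (c • 1) x
    rwa [action_smul_one, action_smul_one] at h

lemma OverBase.Hom.toLinearMap_apply (φ : OverBase.Hom k R V W) (x : V) :
    φ.toLinearMap x = φ.toAddMonoidHom x :=
  rfl

lemma OverBase.Hom.toLinearMap_action (φ : OverBase.Hom k R V W) (r : R) (x : V) :
    φ.toLinearMap (action k V r x) = action k W r (φ.toLinearMap x) :=
  φ.map_action r x

lemma OverBase.Hom.toLinearMap_nprod (φ : OverBase.Hom k R V W) (n : ℤ) (x y : V) :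
    φ.toLinearMap (nprod (k := k) n x y) = nprod (k := k) n (φ.toLinearMap x) (φ.toLinearMap y) :=
  φ.map_nprod n x y

lemma OverBase.Hom.toLinearMap_ι (φ : OverBase.Hom k R V W) (r : R) :
    φ.toLinearMap (ι (k := k) r) = ι (k := k) r :=
  φ.map_ι r

end OverBase

section LoopModule

open Filter

variable {k L L' W : Type*} [Field k] [CharZero k]
  [AddCommGroup L] [Module k L] [VertexAlgebra k L] [OverBase k (RootLaurent k 1) L]
  [AddCommGroup L'] [Module k L'] [VertexAlgebra k L'] [OverBase k (RootLaurent k 1) L']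
  [AddCommGroup W] [Module k W]

/-- Multiplication by `t ^ q` on a vertex algebra over `k[t^{±1}]`. -/
noncomputable def shift (k L : Type*) [Field k] [CharZero k] [AddCommGroup L] [Module k L]
    [VertexAlgebra k L] [OverBase k (RootLaurent k 1) L] (q : ℤ) : Module.End k L :=
  OverBase.action k L (RootLaurent.t 1 q : RootLaurent k 1)

/-- The `i`-th term of the commutator side `(t - t')^l (Y(x, t) Y(y, t') - Y(y, t') Y(x, t))` of the
Jacobi identity, where `ρ` takes the coefficient of `z ^ (-1)` in a vertex operator `Y(x, z)`. -/
noncomputable def jacobiTerm (ρ : L →ₗ[k] Module.End k W) (l : ℤ) (x y : L) (w : W) (i : ℕ) : W :=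
  ((-1) ^ i * Ring.choose l i) • (ρ (shift k L (l - i) x) (ρ (shift k L i y) w) -
    (l.negOnePow : ℤ) • ρ (shift k L (l - i) y) (ρ (shift k L i x) w))

/-- Modules over a vertex algebra `L` over `k[t^{±1}]` on which `t` acts as the formal variable:
`ρ x` is the coefficient of `z ^ (-1)` in the vertex operator `Y(x, z)`, and the other coefficients
are recovered from `Y(t ^ q x, z) = z ^ q Y(x, z)`. -/
structure IsLoopModule (ρ : L →ₗ[k] Module.End k W) : Prop where
  regular (x : L) (w : W) : ∀ᶠ q : ℤ in atTop, ρ (shift k L q x) w = 0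
  vacuum (q : ℤ) :
    ρ (OverBase.ι (k := k) (RootLaurent.t 1 q : RootLaurent k 1)) = if q = -1 then 1 else 0
  jacobi (l : ℤ) (x y : L) (w : W) :
    ρ (nprod (k := k) l x y) w = ∑ᶠ i : ℕ, jacobiTerm ρ l x y w i

lemma hasFiniteSupport_jacobiTerm {ρ : L →ₗ[k] Module.End k W}
    (hρ : ∀ x w, ∀ᶠ q : ℤ in atTop, ρ (shift k L q x) w = 0) (l : ℤ) (x y : L) (w : W) :
    (jacobiTerm ρ l x y w).HasFiniteSupport := by
  have hzero : ∀ᶠ i : ℕ in cofinite, jacobiTerm ρ l x y w i = 0 := by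
    rw [Nat.cofinite_eq_atTop]
    filter_upwards [tendsto_natCast_atTop_atTop.eventually (hρ x w),
      tendsto_natCast_atTop_atTop.eventually (hρ y w)] with i hx hy
    rw [jacobiTerm, hx, hy, map_zero, map_zero, smul_zero, sub_zero, smul_zero]
  exact eventually_cofinite.1 hzero

lemma finsum_jacobiTerm_add_left {ρ : L →ₗ[k] Module.End k W}
    (hρ : ∀ x w, ∀ᶠ q : ℤ in atTop, ρ (shift k L q x) w = 0) (l : ℤ) (x x' y : L) (w : W) :
    ∑ᶠ i, jacobiTerm ρ l (x + x') y w i =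
      ∑ᶠ i, jacobiTerm ρ l x y w i + ∑ᶠ i, jacobiTerm ρ l x' y w i := by
  rw [← finsum_add_distrib (hasFiniteSupport_jacobiTerm hρ l x y w)
    (hasFiniteSupport_jacobiTerm hρ l x' y w)]
  refine finsum_congr fun i => ?_
  simp only [jacobiTerm, map_add, LinearMap.add_apply]
  rw [smul_add (l.negOnePow : ℤ), add_sub_add_comm, smul_add]

lemma finsum_jacobiTerm_add_right {ρ : L →ₗ[k] Module.End k W}
    (hρ : ∀ x w, ∀ᶠ q : ℤ in atTop, ρ (shift k L q x) w = 0) (l : ℤ) (x y y' : L) (w : W) :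
    ∑ᶠ i, jacobiTerm ρ l x (y + y') w i =
      ∑ᶠ i, jacobiTerm ρ l x y w i + ∑ᶠ i, jacobiTerm ρ l x y' w i := by
  rw [← finsum_add_distrib (hasFiniteSupport_jacobiTerm hρ l x y w)
    (hasFiniteSupport_jacobiTerm hρ l x y' w)]
  refine finsum_congr fun i => ?_
  simp only [jacobiTerm, map_add, LinearMap.add_apply]
  rw [smul_add (l.negOnePow : ℤ), add_sub_add_comm, smul_add]

lemma IsLoopModule.comp {ρ : L' →ₗ[k] Module.End k W} (hρ : IsLoopModule ρ)
    (φ : OverBase.Hom k (RootLaurent k 1) L L') : IsLoopModule (ρ ∘ₗ φ.toLinearMap) where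
  regular x w := by
    simpa only [LinearMap.comp_apply, shift, φ.toLinearMap_action] using
      hρ.regular (φ.toLinearMap x) w
  vacuum q := by
    simpa only [LinearMap.comp_apply, φ.toLinearMap_ι] using hρ.vacuum q
  jacobi l x y w := by
    simpa only [jacobiTerm, LinearMap.comp_apply, shift, φ.toLinearMap_action,
      φ.toLinearMap_nprod] using hρ.jacobi l (φ.toLinearMap x) (φ.toLinearMap y) w

end LoopModule

section Eigen

variable {k V : Type*} [Field k] [AddCommGroup V] [Module k V] [VertexAlgebra k V]
  {M : ℕ} {ζ : k} {g : Aut k V}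

lemma mem_eigen_iff {a : ℤ} {v : V} : v ∈ eigen g ζ a ↔ g.toLinearEquiv v = ζ ^ (-a) • v :=
  Module.End.mem_eigenspace_iff

lemma vac_mem_eigen_zero : (vac (k := k) : V) ∈ eigen g ζ 0 := by
  rw [mem_eigen_iff, neg_zero, zpow_zero, one_smul]
  exact g.map_vac

variable [NeZero M]

lemma nprod_mem_eigen (hζ : IsPrimitiveRoot ζ M) {a b : ℤ} {u v : V} (hu : u ∈ eigen g ζ a)
    (hv : v ∈ eigen g ζ b) (n : ℤ) : nprod (k := k) n u v ∈ eigen g ζ (a + b) := by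
  have hg : g.toLinearEquiv (nprod (k := k) n u v) =
    nprod (k := k) n (g.toLinearEquiv u) (g.toLinearEquiv v) := g.map_nprod n u v
  rw [mem_eigen_iff] at hu hv ⊢
  rw [hg, hu, hv, map_smul, map_smul, LinearMap.smul_apply, smul_smul, neg_add_rev,
    zpow_add₀ (hζ.ne_zero (NeZero.ne M))]

lemma eigen_congr (hζ : IsPrimitiveRoot ζ M) {a b : ℤ} (hab : a ≡ b [ZMOD M]) :
    eigen g ζ a = eigen g ζ b := by
  have h : ζ ^ (b - a) = 1 := (hζ.zpow_eq_one_iff_dvd _).2 hab.dvd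
  rw [eigen, eigen, ← sub_add_cancel (-a) (-b), zpow_add₀ (hζ.ne_zero (NeZero.ne M)),
    neg_sub_neg, h, one_mul]

lemma mem_eigen_add_mul (hζ : IsPrimitiveRoot ζ M) {a : ℤ} {v : V} (hv : v ∈ eigen g ζ a)
    (q : ℤ) : v ∈ eigen g ζ (a + q * M) := by
  rwa [eigen_congr hζ (Int.modEq_iff_dvd.2 ⟨-q, by ring⟩ : a + q * M ≡ a [ZMOD M])]

lemma vac_mem_eigen_mul (hζ : IsPrimitiveRoot ζ M) (q : ℤ) :
    (vac (k := k) : V) ∈ eigen g ζ (q * M) := by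
  simpa only [zero_add] using mem_eigen_add_mul hζ vac_mem_eigen_zero q

lemma nprod_mem_eigen_sub_mul (hζ : IsPrimitiveRoot ζ M) {a b : ℤ} {u v : V}
    (hu : u ∈ eigen g ζ a) (hv : v ∈ eigen g ζ b) (n : ℤ) (i : ℕ) :
    nprod (k := k) n u v ∈ eigen g ζ (a + b - i * M) := by
  simpa only [neg_mul, ← sub_eq_add_neg] using
    mem_eigen_add_mul hζ (nprod_mem_eigen hζ hu hv n) (-i)

lemma mem_eigen_iff_zpow_smul_eq (hζ : IsPrimitiveRoot ζ M) {a : ℤ} {v : V} :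
    v ∈ eigen g ζ a ↔ ζ ^ a • g.toLinearEquiv v = v := by
  rw [mem_eigen_iff, zpow_neg, eq_inv_smul_iff₀ (zpow_ne_zero a (hζ.ne_zero (NeZero.ne M)))]

end Eigen

section Coeff

variable {k V : Type*} [Field k] [AddCommGroup V] [Module k V] {M : ℕ}

variable (k V M) in
/-- The coefficient of `t ^ (a / M)` in an element of `V ⊗ k[t^{±1/M}]`. -/
noncomputable def coeff (a : ℤ) : V ⊗[k] RootLaurent k M →ₗ[k] V :=
  Finsupp.lapply a ∘ₗ
    (TensorProduct.equivFinsuppOfBasisRight (M := V) (RootLaurent.basis k M)).toLinearMap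

lemma coeff_tmul_t (a b : ℤ) (v : V) :
    coeff k V M a (v ⊗ₜ RootLaurent.t M b) = if b = a then v else 0 := by
  simp only [coeff, ← RootLaurent.basis_apply, LinearMap.comp_apply, LinearEquiv.coe_coe,
    Finsupp.lapply_apply, TensorProduct.equivFinsuppOfBasisRight_apply_tmul_apply,
    Module.Basis.repr_self, Finsupp.single_apply, ite_smul, one_smul, zero_smul]

end Coeff

section LoopElements

variable {k V : Type*} [Field k] [CharZero k] [AddCommGroup V] [Module k V] [VertexAlgebra k V]
  {M : ℕ} [NeZero M] {ζ : k} {g : Aut k V}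

lemma coeff_loopAut (g : Aut k V) (hζ : IsPrimitiveRoot ζ M) (a : ℤ) (x : V ⊗[k] RootLaurent k M) :
    coeff k V M a (loopAut g hζ x) = ζ ^ a • g.toLinearEquiv (coeff k V M a x) := by
  suffices h : coeff k V M a ∘ₗ loopAut g hζ =
      ζ ^ a • g.toLinearEquiv.toLinearMap ∘ₗ coeff k V M a from LinearMap.congr_fun h x
  refine TensorProduct.ext (LinearMap.ext fun v => (RootLaurent.basis k M).ext fun b => ?_)
  rw [RootLaurent.basis_apply]
  change coeff k V M a (loopAut g hζ (v ⊗ₜ RootLaurent.t M b)) =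
    ζ ^ a • g.toLinearEquiv (coeff k V M a (v ⊗ₜ RootLaurent.t M b))
  rw [loopAut_tmul, RootLaurent.galois_t, TensorProduct.tmul_smul, map_smul, coeff_tmul_t,
    coeff_tmul_t]
  split_ifs with hba
  · rw [hba]
  · rw [map_zero, smul_zero, smul_zero]

lemma coeff_mem_eigen {hζ : IsPrimitiveRoot ζ M} (x : Loop g hζ) (a : ℤ) :
    coeff k V M a x ∈ eigen g ζ a := by
  rw [mem_eigen_iff_zpow_smul_eq hζ, ← coeff_loopAut g hζ, (mem_Loop g hζ _).1 x.2]

lemma exists_eq_sum_loopElt {hζ : IsPrimitiveRoot ζ M} (x : Loop g hζ) :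
    ∃ s : Finset ℤ, x = ∑ a ∈ s, loopElt g hζ a ⟨coeff k V M a x, coeff_mem_eigen x a⟩ := by
  let e := TensorProduct.equivFinsuppOfBasisRight (M := V) (RootLaurent.basis k M)
  refine ⟨(e x).support, Subtype.ext ?_⟩
  rw [AddSubmonoidClass.coe_finsetSum]
  refine (e.symm_apply_apply x).symm.trans ?_
  simp only [e, TensorProduct.equivFinsuppOfBasisRight_symm_apply, RootLaurent.basis_apply]
  rfl

@[elab_as_elim]
lemma loop_induction {hζ : IsPrimitiveRoot ζ M} {p : Loop g hζ → Prop} (x : Loop g hζ)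
    (zero : p 0) (add : ∀ x y, p x → p y → p (x + y))
    (loopElt : ∀ a v, p (loopElt g hζ a v)) : p x := by
  obtain ⟨s, hs⟩ := exists_eq_sum_loopElt x
  rw [hs]
  exact Finset.sum_induction _ p add zero fun a _ => loopElt a _

lemma ι_t (hζ : IsPrimitiveRoot ζ M) (q : ℤ) :
    (OverBase.ι (k := k) (RootLaurent.t 1 q : RootLaurent k 1) : Loop g hζ) =
      loopElt g hζ (q * M) ⟨vac (k := k), vac_mem_eigen_mul hζ q⟩ :=
  Subtype.ext (congrArg ((vac (k := k) : V) ⊗ₜ[k] ·) (RootLaurent.incl_t M q))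

lemma nprod_neg_one_vac_tmul (v : V) (s s' : RootLaurent k M) :
    nprod (k := k) (-1) ((vac (k := k) : V) ⊗ₜ[k] s) (v ⊗ₜ[k] s') = v ⊗ₜ[k] (s * s') := by
  refine (tensorProd_tmul_range (-1) _ v s s' 1 fun j hj => ?_).trans ?_
  · rw [vac_nprod, if_neg (by lia)]
  · rw [Finset.sum_range_one, vac_nprod, if_pos (by simp), HasseSchmidt.D_zero]

lemma shift_loopElt (hζ : IsPrimitiveRoot ζ M) (q a : ℤ) (v : eigen g ζ a) :
    shift k (Loop g hζ) q (loopElt g hζ a v) =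
      loopElt g hζ (a + q * M) ⟨v, mem_eigen_add_mul hζ v.2 q⟩ := by
  refine Subtype.ext ((nprod_neg_one_vac_tmul (v : V) _ _).trans ?_)
  rw [AlgHom.toLinearMap_apply, RootLaurent.incl_t, ← RootLaurent.t_add, add_comm]
  rfl

lemma map_nprod_loopElt {U : Type*} [AddCommGroup U] [Module k U] (hζ : IsPrimitiveRoot ζ M)
    (f : Loop g hζ →ₗ[k] U) (l a b : ℤ) (u : eigen g ζ a) (v : eigen g ζ b) :
    f (nprod (k := k) l (loopElt g hζ a u) (loopElt g hζ b v)) =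
      ∑ᶠ i : ℕ, Ring.choose ((a : k) / (M : k)) i • f (loopElt g hζ (a + b - i * M)
        ⟨nprod (k := k) (l + i) (u : V) (v : V), nprod_mem_eigen_sub_mul hζ u.2 v.2 _ i⟩) := by
  obtain ⟨K, hK⟩ := exists_bound_shift (k := k) (u : V) (v : V) l
  have hzero (i : ℕ) (hi : K ≤ i) : loopElt g hζ (a + b - i * M)
      ⟨nprod (k := k) (l + i) (u : V) (v : V), nprod_mem_eigen_sub_mul hζ u.2 v.2 _ i⟩ = 0 :=
    Subtype.ext (by simp only [loopElt, hK i hi, TensorProduct.zero_tmul, ZeroMemClass.coe_zero])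
  rw [finsum_eq_range _ K fun i hi => by rw [hzero i hi, map_zero, smul_zero]]
  simp only [← map_smul, ← map_sum]
  congr 1
  refine Subtype.ext ((tensorProd_tmul_range l _ _ _ _ K hK).trans ?_)
  rw [AddSubmonoidClass.coe_finsetSum]
  refine Finset.sum_congr rfl fun i _ => ?_
  rw [RootLaurent.D_t, smul_mul_assoc, ← RootLaurent.t_add, TensorProduct.tmul_smul,
    sub_add_eq_add_sub]
  rfl

end LoopElements

section TwistedToLoop

open Filter

variable {k V W : Type*} [Field k] [CharZero k] [AddCommGroup V] [Module k V] [VertexAlgebra k V]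
  [AddCommGroup W] [Module k W] {M : ℕ} [NeZero M] {ζ : k} {h : Aut k V}
  {Y : ℤ → V →ₗ[k] Module.End k W}

lemma modeMap_shift_loopElt (hζ : IsPrimitiveRoot ζ M) (q a : ℤ) (v : eigen h ζ a) :
    modeMap h hζ Y (shift k (Loop h hζ) q (loopElt h hζ a v)) = Y (a + q * M) v := by
  rw [shift_loopElt, modeMap_loopElt]

lemma modeMap_regular (hζ : IsPrimitiveRoot ζ M) (hY : IsWeakTwistedModule h M ζ Y)
    (x : Loop h hζ) (w : W) :
    ∀ᶠ q : ℤ in atTop, modeMap h hζ Y (shift k (Loop h hζ) q x) w = 0 := by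
  induction x using loop_induction with
  | zero => simp only [map_zero, LinearMap.zero_apply, eventually_true]
  | add x x' hx hx' =>
    filter_upwards [hx, hx'] with q hq hq'
    rw [map_add, map_add, LinearMap.add_apply, hq, hq', add_zero]
  | loopElt a v =>
    have hM : (0 : ℤ) < M := Nat.cast_pos.2 (NeZero.pos M)
    have hlim : Tendsto (fun q : ℤ => a + q * M) atTop atTop :=
      tendsto_atTop_add_const_left _ a (tendsto_id.atTop_mul_const' hM)
    simpa only [modeMap_shift_loopElt] using
      hlim.eventually (eventually_atTop.2 (hY.regular (v : V) w))

lemma modeMap_ι_t (hζ : IsPrimitiveRoot ζ M) (hY : IsWeakTwistedModule h M ζ Y) (q : ℤ) :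
    modeMap h hζ Y (OverBase.ι (k := k) (RootLaurent.t 1 q : RootLaurent k 1)) =
      if q = -1 then 1 else 0 := by
  have hM : (M : ℤ) ≠ 0 := Nat.cast_ne_zero.2 (NeZero.ne M)
  have hq : q * M = -M ↔ q = -1 := by rw [← neg_one_mul, mul_left_inj' hM]
  rw [ι_t hζ, modeMap_loopElt, hY.vacuum]
  simp only [hq]

lemma modeMap_jacobi (hζ : IsPrimitiveRoot ζ M) (hY : IsWeakTwistedModule h M ζ Y) (l : ℤ)
    (x y : Loop h hζ) (w : W) :
    modeMap h hζ Y (nprod (k := k) l x y) w = ∑ᶠ i, jacobiTerm (modeMap h hζ Y) l x y w i := by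
  have hreg := modeMap_regular hζ hY
  induction x using loop_induction with
  | zero => simp [jacobiTerm]
  | add x x' hx hx' =>
    rw [finsum_jacobiTerm_add_left hreg, ← hx, ← hx', map_add, LinearMap.add_apply, map_add,
      LinearMap.add_apply]
  | loopElt a u =>
  induction y using loop_induction with
  | zero => simp [jacobiTerm]
  | add y y' hy hy' =>
    rw [finsum_jacobiTerm_add_right hreg, ← hy, ← hy', map_add, map_add, LinearMap.add_apply]
  | loopElt b v =>
    change ((modeMap h hζ Y).flip w) _ = _
    rw [map_nprod_loopElt]
    simpa only [jacobiTerm, modeMap_shift_loopElt, LinearMap.flip_apply, modeMap_loopElt] using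
      hY.jacobi a b l u u.2 v w

theorem IsWeakTwistedModule.isLoopModule_modeMap (hζ : IsPrimitiveRoot ζ M)
    (hY : IsWeakTwistedModule h M ζ Y) : IsLoopModule (modeMap h hζ Y) :=
  ⟨modeMap_regular hζ hY, modeMap_ι_t hζ hY, modeMap_jacobi hζ hY⟩

end TwistedToLoop

section EigenProj

variable {k V : Type*} [Field k] [AddCommGroup V] [Module k V] [VertexAlgebra k V]
  {M : ℕ} {ζ : k} {g : Aut k V}

/-- The projection of `V = ⨁ V^{g,r}` onto `V^{g,a}`, when `g` has period `M` and `ζ` is a primitive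
`M`-th root of unity. -/
noncomputable def eigenProj (g : Aut k V) (M : ℕ) (ζ : k) (a : ℤ) : Module.End k V :=
  average M (ζ ^ a • g.toLinearEquiv.toLinearMap)

lemma zpow_pow_eq_one (hζ : IsPrimitiveRoot ζ M) (a : ℤ) : (ζ ^ a) ^ M = 1 := by
  rw [← zpow_natCast, zpow_comm, zpow_natCast, hζ.pow_eq_one, one_zpow]

variable [NeZero M]

lemma eigenProj_mem_eigen (hζ : IsPrimitiveRoot ζ M) (hg : g.toLinearEquiv ^ M = 1) (a : ℤ)
    (v : V) : eigenProj g M ζ a v ∈ eigen g ζ a := by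
  have hgM : g.toLinearEquiv.toLinearMap ^ M = 1 := by
    have h := congrArg (LinearEquiv.automorphismGroup.toLinearMapMonoidHom (R := k) (M := V)) hg
    rwa [map_pow, map_one] at h
  have hpow : (ζ ^ a • g.toLinearEquiv.toLinearMap) ^ M = 1 := by
    rw [smul_pow, hgM, zpow_pow_eq_one hζ, one_smul]
  rw [mem_eigen_iff_zpow_smul_eq hζ]
  exact LinearMap.congr_fun (mul_average hpow) v

lemma eigenProj_apply_of_mem_eigen [CharZero k] (hζ : IsPrimitiveRoot ζ M) {a : ℤ} {v : V}
    (hv : v ∈ eigen g ζ a) : eigenProj g M ζ a v = v :=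
  average_apply_eq_self ((mem_eigen_iff_zpow_smul_eq hζ).1 hv)

lemma eigenProj_apply_eq_zero (hζ : IsPrimitiveRoot ζ M) {a r : ℤ} {v : V}
    (hv : v ∈ eigen g ζ r) (har : ¬ a ≡ r [ZMOD M]) : eigenProj g M ζ a v = 0 := by
  refine average_apply_eq_zero (c := ζ ^ (a - r)) ?_ (zpow_pow_eq_one hζ _) ?_
  · rw [LinearMap.smul_apply, LinearEquiv.coe_coe, mem_eigen_iff.1 hv, smul_smul,
      ← zpow_add₀ (hζ.ne_zero (NeZero.ne M)), sub_eq_add_neg]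
  · rw [Ne, hζ.zpow_eq_one_iff_dvd]
    exact fun hdvd => har (Int.modEq_iff_dvd.2 hdvd).symm

lemma eigenProj_congr (hζ : IsPrimitiveRoot ζ M) {a b : ℤ} (hab : a ≡ b [ZMOD M]) :
    eigenProj g M ζ a = eigenProj g M ζ b := by
  have h : ζ ^ (b - a) = 1 := (hζ.zpow_eq_one_iff_dvd _).2 hab.dvd
  rw [eigenProj, eigenProj, ← sub_add_cancel b a, zpow_add₀ (hζ.ne_zero (NeZero.ne M)), h, one_mul]

lemma eigenProj_nprod (hζ : IsPrimitiveRoot ζ M) {a : ℤ} {u : V} (hu : u ∈ eigen g ζ a)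
    (b n : ℤ) (v : V) :
    eigenProj g M ζ (a + b) (nprod (k := k) n u v) = nprod (k := k) n u (eigenProj g M ζ b v) := by
  refine LinearMap.congr_fun (average_comp_of_comp_eq (LinearMap.ext fun v => ?_) M) v
  have hg : g.toLinearEquiv (nprod (k := k) n u v) =
    nprod (k := k) n (g.toLinearEquiv u) (g.toLinearEquiv v) := g.map_nprod n u v
  calc ζ ^ (a + b) • g.toLinearEquiv (nprod (k := k) n u v)
      = nprod (k := k) n (ζ ^ a • g.toLinearEquiv u) (ζ ^ b • g.toLinearEquiv v) := by
        rw [hg, map_smul, map_smul, LinearMap.smul_apply, smul_smul, add_comm,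
          zpow_add₀ (hζ.ne_zero (NeZero.ne M))]
    _ = nprod (k := k) n u (ζ ^ b • g.toLinearEquiv v) := by
        rw [(mem_eigen_iff_zpow_smul_eq hζ).1 hu]

lemma iSup_eigen_eq_top [CharZero k] (hζ : IsPrimitiveRoot ζ M) (hg : g.toLinearEquiv ^ M = 1) :
    ⨆ r, eigen g ζ r = ⊤ := by
  refine eq_top_iff.2 fun v _ => ?_
  have hv := LinearMap.congr_fun (sum_average_smul hζ g.toLinearEquiv.toLinearMap) v
  rw [LinearMap.sum_apply, Module.End.one_apply] at hv
  rw [← hv]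
  refine Submodule.sum_mem _ fun s _ => Submodule.mem_iSup_of_mem (s : ℤ) ?_
  simpa only [eigenProj, zpow_natCast] using eigenProj_mem_eigen hζ hg s v

end EigenProj

section LoopToTwisted

open Filter

variable {k V W : Type*} [Field k] [CharZero k] [AddCommGroup V] [Module k V] [VertexAlgebra k V]
  [AddCommGroup W] [Module k W] {M : ℕ} [NeZero M] {ζ : k} {g : Aut k V}

/-- The map `V → L(V, g)` sending `v` to `v' ⊗ t ^ (a / M)`, where `v'` is the component of `v` in
`V^{g,a}`. -/
noncomputable def toLoop (hζ : IsPrimitiveRoot ζ M) (hg : g.toLinearEquiv ^ M = 1) (a : ℤ) :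
    V →ₗ[k] Loop g hζ :=
  ((TensorProduct.mk k V (RootLaurent k M)).flip (RootLaurent.t M a) ∘ₗ
    eigenProj g M ζ a).codRestrict (Loop g hζ) fun v =>
      tmul_t_mem_Loop g hζ a ⟨_, eigenProj_mem_eigen hζ hg a v⟩

lemma toLoop_apply (hζ : IsPrimitiveRoot ζ M) (hg : g.toLinearEquiv ^ M = 1) (a : ℤ) (v : V) :
    toLoop hζ hg a v = loopElt g hζ a ⟨_, eigenProj_mem_eigen hζ hg a v⟩ :=
  rfl

lemma toLoop_apply_of_mem_eigen (hζ : IsPrimitiveRoot ζ M) (hg : g.toLinearEquiv ^ M = 1) {a : ℤ}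
    {v : V} (hv : v ∈ eigen g ζ a) : toLoop hζ hg a v = loopElt g hζ a ⟨v, hv⟩ := by
  simp only [toLoop_apply, eigenProj_apply_of_mem_eigen hζ hv]

lemma toLoop_apply_eq_zero (hζ : IsPrimitiveRoot ζ M) (hg : g.toLinearEquiv ^ M = 1) {a r : ℤ}
    {v : V} (hv : v ∈ eigen g ζ r) (har : ¬ a ≡ r [ZMOD M]) : toLoop hζ hg a v = 0 :=
  Subtype.ext (by
    simp only [toLoop_apply, loopElt, eigenProj_apply_eq_zero hζ hv har, TensorProduct.zero_tmul,
      ZeroMemClass.coe_zero])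

lemma shift_toLoop (hζ : IsPrimitiveRoot ζ M) (hg : g.toLinearEquiv ^ M = 1) (q a : ℤ) (v : V) :
    shift k (Loop g hζ) q (toLoop hζ hg a v) = toLoop hζ hg (a + q * M) v := by
  have ha : a + q * M ≡ a [ZMOD M] := Int.modEq_iff_dvd.2 ⟨-q, by ring⟩
  simp only [toLoop_apply, shift_loopElt, eigenProj_congr hζ ha]

lemma toLoop_vac (hζ : IsPrimitiveRoot ζ M) (hg : g.toLinearEquiv ^ M = 1) (q : ℤ) :
    toLoop hζ hg (q * M) (vac (k := k) : V) =
      OverBase.ι (k := k) (RootLaurent.t 1 q : RootLaurent k 1) := by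
  rw [toLoop_apply_of_mem_eigen hζ hg (vac_mem_eigen_mul hζ q), ι_t hζ]

lemma map_nprod_toLoop {U : Type*} [AddCommGroup U] [Module k U] (hζ : IsPrimitiveRoot ζ M)
    (hg : g.toLinearEquiv ^ M = 1) (f : Loop g hζ →ₗ[k] U) (l a b : ℤ) {u : V}
    (hu : u ∈ eigen g ζ a) (v : V) :
    f (nprod (k := k) l (toLoop hζ hg a u) (toLoop hζ hg b v)) =
      ∑ᶠ i : ℕ, Ring.choose ((a : k) / (M : k)) i •
        f (toLoop hζ hg (a + b - i * M) (nprod (k := k) (l + i) u v)) := by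
  rw [toLoop_apply_of_mem_eigen hζ hg hu, toLoop_apply hζ hg b, map_nprod_loopElt]
  refine finsum_congr fun i => ?_
  have hi : a + b - i * M ≡ a + b [ZMOD M] := Int.modEq_iff_dvd.2 ⟨i, by ring⟩
  simp only [toLoop_apply, eigenProj_congr hζ hi, eigenProj_nprod hζ hu]

lemma eventually_toLoop_eq_zero {hζ : IsPrimitiveRoot ζ M} (hg : g.toLinearEquiv ^ M = 1)
    {ρ : Loop g hζ →ₗ[k] Module.End k W} (hρ : IsLoopModule ρ) (v : V) (w : W) :
    ∀ᶠ a : ℤ in atTop, ρ (toLoop hζ hg a v) w = 0 := by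
  have hv : v ∈ ⨆ r, eigen g ζ r := iSup_eigen_eq_top hζ hg ▸ Submodule.mem_top
  induction hv using Submodule.iSup_induction' with
  | zero => simp only [map_zero, LinearMap.zero_apply, eventually_true]
  | add v v' _ _ hv hv' =>
    filter_upwards [hv, hv'] with a ha ha'
    rw [map_add, map_add, LinearMap.add_apply, ha, ha', add_zero]
  | mem r v hv =>
    have hM : (0 : ℤ) < M := Nat.cast_pos.2 (NeZero.pos M)
    obtain ⟨N, hN⟩ := eventually_atTop.1 (hρ.regular (toLoop hζ hg r v) w)
    filter_upwards [eventually_ge_atTop (r + N * M)] with a ha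
    by_cases har : a ≡ r [ZMOD M]
    · obtain ⟨q, hq⟩ := har.symm.dvd
      obtain rfl : a = r + q * M := by rw [mul_comm q, ← hq, add_sub_cancel]
      rw [← shift_toLoop, hN q (le_of_mul_le_mul_right (le_of_add_le_add_left ha) hM)]
    · rw [toLoop_apply_eq_zero hζ hg hv har, map_zero, LinearMap.zero_apply]

/-- The modes `v_n`, `n = a / M`, of the vertex operators on `W` attached to a module over
`L(V, g)`. -/
noncomputable def twistedModes (hζ : IsPrimitiveRoot ζ M) (hg : g.toLinearEquiv ^ M = 1)
    (ρ : Loop g hζ →ₗ[k] Module.End k W) (a : ℤ) : V →ₗ[k] Module.End k W :=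
  ρ ∘ₗ toLoop hζ hg a

lemma twistedModes_apply {hζ : IsPrimitiveRoot ζ M} (hg : g.toLinearEquiv ^ M = 1)
    (ρ : Loop g hζ →ₗ[k] Module.End k W) {a : ℤ} {v : V} (hv : v ∈ eigen g ζ a) :
    twistedModes hζ hg ρ a v = ρ (loopElt g hζ a ⟨v, hv⟩) := by
  rw [twistedModes, LinearMap.comp_apply, toLoop_apply_of_mem_eigen hζ hg hv]

lemma twistedModes_eq_zero {hζ : IsPrimitiveRoot ζ M} (hg : g.toLinearEquiv ^ M = 1)
    (ρ : Loop g hζ →ₗ[k] Module.End k W) {a r : ℤ} {v : V} (hv : v ∈ eigen g ζ r)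
    (har : ¬ a ≡ r [ZMOD M]) : twistedModes hζ hg ρ a v = 0 := by
  rw [twistedModes, LinearMap.comp_apply, toLoop_apply_eq_zero hζ hg hv har, map_zero]

theorem IsLoopModule.isWeakTwistedModule {hζ : IsPrimitiveRoot ζ M} (hg : g.toLinearEquiv ^ M = 1)
    {ρ : Loop g hζ →ₗ[k] Module.End k W} (hρ : IsLoopModule ρ) :
    IsWeakTwistedModule g M ζ (twistedModes hζ hg ρ) where
  support r a v hv har := twistedModes_eq_zero hg ρ hv har
  regular v w := eventually_atTop.1 (eventually_toLoop_eq_zero hg hρ v w)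
  vacuum a := by
    have hM : (M : ℤ) ≠ 0 := Nat.cast_ne_zero.2 (NeZero.ne M)
    by_cases ha : (M : ℤ) ∣ a
    · obtain ⟨q, rfl⟩ := exists_eq_mul_left_of_dvd ha
      have hq : q * M = -M ↔ q = -1 := by rw [← neg_one_mul, mul_left_inj' hM]
      simp only [twistedModes, LinearMap.comp_apply, toLoop_vac, hρ.vacuum, hq]
    · rw [twistedModes_eq_zero hg ρ vac_mem_eigen_zero (mt Int.modEq_zero_iff_dvd.1 ha), if_neg]
      rintro rfl
      exact ha (dvd_neg.2 dvd_rfl)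
  jacobi a b l u hu v w := by
    simp only [twistedModes, LinearMap.comp_apply, ← shift_toLoop]
    refine (map_nprod_toLoop hζ hg (ρ.flip w) l a b hu v).symm.trans ?_
    exact hρ.jacobi l (toLoop hζ hg a u) (toLoop hζ hg b v) w

end LoopToTwisted

section Pullback

variable {k V W : Type*} [Field k] [CharZero k] [AddCommGroup V] [Module k V] [VertexAlgebra k V]
  [AddCommGroup W] [Module k W] {M : ℕ} [NeZero M] {ζ : k} {g h : Aut k V}

lemma isPullback_iff {hζ : IsPrimitiveRoot ζ M} (hg : g.toLinearEquiv ^ M = 1)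
    (φ : OverBase.Hom k (RootLaurent k 1) (Loop g hζ) (Loop h hζ))
    (Y Y' : ℤ → V →ₗ[k] Module.End k W) :
    IsPullback φ Y Y' ↔ Y' = twistedModes hζ hg (modeMap h hζ Y ∘ₗ φ.toLinearMap) := by
  have happly (a : ℤ) (v : eigen g ζ a) :
      twistedModes hζ hg (modeMap h hζ Y ∘ₗ φ.toLinearMap) a v =
        modeMap h hζ Y (φ.toAddMonoidHom (loopElt g hζ a v)) := by
    rw [twistedModes_apply hg _ v.2, LinearMap.comp_apply, φ.toLinearMap_apply]
  constructor
  · intro hY'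
    funext a
    rw [← LinearMap.eqLocus_eq_top, eq_top_iff, ← iSup_eigen_eq_top hζ hg]
    refine iSup_le fun r v hv => LinearMap.mem_eqLocus.2 ?_
    by_cases har : a ≡ r [ZMOD M]
    · have hva : v ∈ eigen g ζ a := by rwa [eigen_congr hζ har]
      rw [hY'.mode a ⟨v, hva⟩, happly a ⟨v, hva⟩]
    · rw [hY'.support r a v hv har, twistedModes_eq_zero hg _ hv har]
  · rintro rfl
    exact ⟨happly, fun r a v => twistedModes_eq_zero hg _⟩

end Pullback

end VertexAlgebra

theorem mainTheorem7_general {k : Type*} [Field k] [CharZero k]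
    {V : Type*} [AddCommGroup V] [Module k V] [VertexAlgebra k V]
    {M : ℕ} [NeZero M] {ζ : k} (hζ : IsPrimitiveRoot ζ M)
    (g h : VertexAlgebra.Aut k V) (hg : g.toLinearEquiv ^ M = 1)
    (φ : VertexAlgebra.OverBase.Hom k (RootLaurent k 1)
      (VertexAlgebra.Loop g hζ) (VertexAlgebra.Loop h hζ))
    {W : Type*} [AddCommGroup W] [Module k W]
    (Y : ℤ → V →ₗ[k] Module.End k W) (hY : VertexAlgebra.IsWeakTwistedModule h M ζ Y) :
    ∃ Y' : ℤ → V →ₗ[k] Module.End k W,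
      VertexAlgebra.IsPullback φ Y Y' ∧
      (∀ Y'' : ℤ → V →ₗ[k] Module.End k W, VertexAlgebra.IsPullback φ Y Y'' → Y'' = Y') ∧
      VertexAlgebra.IsWeakTwistedModule g M ζ Y' := by
  let ρ := VertexAlgebra.modeMap h hζ Y ∘ₗ φ.toLinearMap
  have hρ : VertexAlgebra.IsLoopModule ρ := (hY.isLoopModule_modeMap hζ).comp φ
  exact ⟨VertexAlgebra.twistedModes hζ hg ρ,
    (VertexAlgebra.isPullback_iff hg φ Y _).2 rfl,
    fun Y'' => (VertexAlgebra.isPullback_iff hg φ Y Y'').1,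
    hρ.isWeakTwistedModule hg⟩

theorem mainTheorem7 {k : Type*} [Field k] [CharZero k]
    {V : Type*} [AddCommGroup V] [Module k V] [VertexAlgebra k V]
    {M : ℕ} [NeZero M] {ζ : k} (hζ : IsPrimitiveRoot ζ M)
    (g h : VertexAlgebra.Aut k V)
    (hg : g.toLinearEquiv ^ M = 1) (hh : h.toLinearEquiv ^ M = 1)
    (φ : VertexAlgebra.OverBase.Hom k (RootLaurent k 1)
      (VertexAlgebra.Loop g hζ) (VertexAlgebra.Loop h hζ))
    {W : Type*} [AddCommGroup W] [Module k W]
    (Y : ℤ → V →ₗ[k] Module.End k W) (hY : VertexAlgebra.IsWeakTwistedModule h M ζ Y) :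
    ∃ Y' : ℤ → V →ₗ[k] Module.End k W,
      VertexAlgebra.IsPullback φ Y Y' ∧
      (∀ Y'' : ℤ → V →ₗ[k] Module.End k W, VertexAlgebra.IsPullback φ Y Y'' → Y'' = Y') ∧
      VertexAlgebra.IsWeakTwistedModule g M ζ Y' :=
  mainTheorem7_general hζ g h hg φ Y hY
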